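/- All systems are finite-dimensional. For $\lambda>1$ and positive semidefinite matrices $\rho,\sigma$ (not necessarily of unit trace) let $$D_\lambda(\rho\|\sigma)=\frac{1}{\lambda-1}\ln\mathrm{Tr}\,\rho^{\lambda}\sigma^{1-\lambda}$$ be the Petz Rényi divergence, equal to $+\infty$ unless $\operatorname{supp}\rho\subseteq\operatorname{supp}\sigma$ (negative powers are taken on the support). For $\alpha\in[0,1]$ and $\beta\in(0,1]$ let $\mathbb{D}_\lambda(\alpha\|\beta)=D_\lambda(\alpha\Pi_0+(1-\alpha)\Pi_1\,\|\,\beta\Pi_0+(1/\beta-\beta)\Pi_1)$, where $\Pi_0=|0\rangle\langle 0|$ and $\Pi_1=|1\rangle\langle 1|$ are the coordinate projectors of a qubit. For a state $\rho^{AB}$ let $K_\lambda(A\rangle B)_\rho=\inf_{\sigma^B}D_\lambda(\rho^{AB}\|\mathbb{1}\otimes\sigma^B)$, the infimum being over all density matrices $\sigma^B$. For a quantum channel $\mathcal{M}^{X\to B}$, a state $\rho^{AX}$, $\rho^{AB}=(\mathrm{id}_A\otimes\mathcal{M})(\rho^{AX})$ and $s\in[-1/2,0)$, let $$E_0(s,\mathcal{M})_\rho=-\ln\mathrm{Tr}\Big[\mathrm{Tr}_A\big(\rho^{AB}\big)^{1/(s+1)}\Big]^{s+1}.$$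 Let $\mathcal{N}^{A'\to B}$ be a quantum channel (a completely positive trace preserving map) and $n\ge 1$. A protocol for entanglement transmission by $n$ uses of $\mathcal{N}$ consists of a pure state $|\phi\rangle^{AS}$ of a reference system $A$ and a system $S$ whose reduced state on $S$ is $\mathbb{1}/|S|$, an encoding channel $\mathcal{E}^{S\to A'^n}$ and a decoding channel $\mathcal{T}^{B^n\to\hat S}$ with $\hat S$ a copy of $S$. Put $\rho^{AA'^n}=\mathcal{E}(\phi^{AS})$, $\rho^{AB^n}=\mathcal{N}^{\otimes n}(\rho^{AA'^n})$ and $\rho^{A\hat S}=\mathcal{T}(\rho^{AB^n})$, all maps acting as the identity on $A$. The protocol is an $(n,\mathcal{R},1-\mathbb{F})$ code if $\mathcal{R}=\frac1n\ln|S|$ and $\langle\phi|\rho^{A\hat S}|\phi\rangle\ge\mathbb{F}$. Theorem. If $\mathbb{F}\ge e^{-n\mathcal{R}}$, then every $(n,\mathcal{R},1-\mathbb{F})$ code satisfies $$\mathbb{D}_\lambda(\mathbb{F}\|e^{-n\mathcal{R}})\le K_\lambda(A\rangle B^n)_\rho\qquad\text{for all }\lambda\in(1,2],$$ and $$\mathbb{F}\le\exp\big(sn\mathcal{R}-E_0(s,\mathcal{N}^{\otimes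 n})_\rho\big)\qquad\text{for all }s\in[-1/2,0),$$ where $E_0$ is taken at the state $\rho^{AA'^n}$. -/

import Mathlib

/- Finite-dimensional quantum systems are labelled by finite types: the system `a` has the Hilbert
space `ℂ^a` with its standard orthonormal basis, operators on it are complex matrices indexed by
`a`, and a joint system is labelled by the product of the labels. The `n`-fold system `a^n` is
labelled by `Fin n → a`. -/

namespace QInfo

open scoped ComplexOrder

/-- Density matrices: positive semidefinite matrices of unit trace. -/
def IsDensity {a : Type*} [Fintype a] (ρ : Matrix a a ℂ) : Prop :=
  ρ.PosSemidef ∧ ρ.trace = 1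

/-- The partial trace over the first of two systems. -/
def traceFst {a b : Type*} [Fintype a] (M : Matrix (a × b) (a × b) ℂ) : Matrix b b ℂ :=
  Matrix.of fun i j => ∑ x : a, M (x, i) (x, j)

/-- The map `id_r ⊗ Φ` on operators of a joint system: `Φ` acts on every block of a block matrix
whose blocks are indexed by `r`. -/
def ampliate (r : Type*) {a b : Type*} (Φ : Matrix a a ℂ →ₗ[ℂ] Matrix b b ℂ) :
    Matrix (r × a) (r × a) ℂ →ₗ[ℂ] Matrix (r × b) (r × b) ℂ where
  toFun M := Matrix.of fun x y => Φ (Matrix.of fun i j => M (x.1, i) (y.1, j)) x.2 y.2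
  map_add' M N := by
    ext x y
    exact congrFun (congrFun (Φ.map_add (Matrix.of fun i j => M (x.1, i) (y.1, j))
      (Matrix.of fun i j => N (x.1, i) (y.1, j))) x.2) y.2
  map_smul' c M := by
    ext x y
    exact congrFun (congrFun (Φ.map_smul c (Matrix.of fun i j => M (x.1, i) (y.1, j))) x.2) y.2

/-- A quantum channel (quantum operation): a completely positive, trace preserving linear map. -/
structure Channel (a b : Type*) [Fintype a] [Fintype b] where
  /-- the underlying linear map on operators -/
  map : Matrix a a ℂ →ₗ[ℂ] Matrix b b ℂ
  completelyPositive : ∀ (k : ℕ) (M : Matrix (Fin k × a) (Fin k × a) ℂ),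
    M.PosSemidef → (ampliate (Fin k) map M).PosSemidef
  tracePreserving : ∀ M : Matrix a a ℂ, (map M).trace = M.trace

/-- The tensor power `Φ^{⊗n}`, a map from operators on `a^n` to operators on `b^n`: it sends the
matrix unit `|x⟩⟨y| = ⨂ₖ |x k⟩⟨y k|` to `⨂ₖ Φ(|x k⟩⟨y k|)`. -/
def tensorPower (n : ℕ) {a b : Type*} [Fintype a] [DecidableEq a]
    (Φ : Matrix a a ℂ →ₗ[ℂ] Matrix b b ℂ) :
    Matrix (Fin n → a) (Fin n → a) ℂ →ₗ[ℂ] Matrix (Fin n → b) (Fin n → b) ℂ where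
  toFun M := Matrix.of fun u v =>
    ∑ x : Fin n → a, ∑ y : Fin n → a,
      M x y * ∏ k : Fin n, Φ (Matrix.single (x k) (y k) 1) (u k) (v k)
  map_add' M N := by
    ext u v
    simp [add_mul, Finset.sum_add_distrib]
  map_smul' c M := by
    ext u v
    simp [mul_assoc, Finset.mul_sum]

/-- The `t`-th power of a positive semidefinite matrix, by functional calculus on its spectrum.
Since `0 ^ t = 0` for real `t ≠ 0`, negative powers are taken on the support. -/
noncomputable def mpow {a : Type*} [Fintype a] [DecidableEq a] (ρ : Matrix a a ℂ) (t : ℝ) :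
    Matrix a a ℂ :=
  cfc (fun x : ℝ => x ^ t) ρ

open Classical in
/-- `Tr ρ^lam σ^(1 - lam)` for `lam > 1` and positive semidefinite `ρ`, `σ`. It is infinite unless
the support of `ρ` is contained in the support of `σ`. -/
noncomputable def renyiTrace {a : Type*} [Fintype a] [DecidableEq a] (lam : ℝ)
    (ρ σ : Matrix a a ℂ) : ENNReal :=
  if ∀ v : a → ℂ, σ.mulVec v = 0 → ρ.mulVec v = 0 then
    ENNReal.ofReal (mpow ρ lam * mpow σ (1 - lam)).trace.re
  else ⊤

/-- The (Petz) quantum Rényi divergence `D_lam(ρ ‖ σ) = (lam - 1)⁻¹ ln Tr ρ^lam σ^(1 - lam)` of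
order `lam > 1`, for positive semidefinite `ρ`, `σ` that need not have unit trace. -/
noncomputable def renyiDiv {a : Type*} [Fintype a] [DecidableEq a] (lam : ℝ)
    (ρ σ : Matrix a a ℂ) : EReal :=
  ((lam - 1)⁻¹ : ℝ) * ENNReal.log (renyiTrace lam ρ σ)

/-- The divergence `D_lam(ρ ‖ σ)` of `ρ = α Π₀ + (1 - α) Π₁` from `σ = β Π₀ + (1/β - β) Π₁`, where
`Π₀`, `Π₁` are the two coordinate projectors of a qubit, `α ∈ [0, 1]` and `β ∈ (0, 1]`. -/
noncomputable def binaryDiv (lam α β : ℝ) : EReal :=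
  renyiDiv lam (Matrix.diagonal ![(α : ℂ), ((1 - α : ℝ) : ℂ)])
    (Matrix.diagonal ![(β : ℂ), ((1 / β - β : ℝ) : ℂ)])

/-- `K_lam(A⟩B)_ρ`, the infimum of `D_lam(ρ^{AB} ‖ 𝟙 ⊗ σ^B)` over all density matrices `σ^B`. -/
noncomputable def condDiv {a b : Type*} [Fintype a] [DecidableEq a] [Fintype b] [DecidableEq b]
    (lam : ℝ) (ρ : Matrix (a × b) (a × b) ℂ) : EReal :=
  ⨅ (σ : Matrix b b ℂ) (_ : IsDensity σ),
    renyiDiv lam ρ (Matrix.kronecker (1 : Matrix a a ℂ) σ)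

/-- `E₀(s, Φ)_ρ = - ln Tr [Tr_A (ρ^{AB})^(1/(s+1))]^(s+1)` with `ρ^{AB} = (id_A ⊗ Φ)(ρ^{AX})`, for a
map `Φ` from operators on `x` to operators on `b` and a state `ρ` of the joint system `a × x`. -/
noncomputable def gallagerE0 {a x b : Type*} [Fintype a] [DecidableEq a] [Fintype b]
    [DecidableEq b] (s : ℝ) (Φ : Matrix x x ℂ →ₗ[ℂ] Matrix b b ℂ)
    (ρ : Matrix (a × x) (a × x) ℂ) : ℝ :=
  -Real.log (mpow (traceFst (mpow (ampliate a Φ ρ) (1 / (s + 1)))) (s + 1)).trace.re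

/-- A protocol for entanglement transmission by `n` independent uses of the channel `N`: a pure
state `φ` of the reference system `A` and the system `S` in which `S` is completely mixed, an
encoding operation from `S` to `X^n`, and a decoding operation from `Y^n` to a copy of `S`. -/
structure Protocol {X Y : Type*} [Fintype X] [Fintype Y] (N : Channel X Y) (n : ℕ)
    (A S : Type*) [Fintype A] [Fintype S] [DecidableEq S] where
  /-- the state vector shared between the reference and the sender -/
  φ : A × S → ℂ
  norm_φ : star φ ⬝ᵥ φ = 1
  mixed_φ : traceFst (Matrix.vecMulVec φ (star φ)) = (Fintype.card S : ℂ)⁻¹ • 1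
  /-- the encoding operation -/
  enc : Channel S (Fin n → X)
  /-- the decoding operation -/
  dec : Channel (Fin n → Y) S

namespace Protocol

variable {X Y : Type*} [Fintype X] [DecidableEq X] [Fintype Y] {N : Channel X Y} {n : ℕ}
  {A S : Type*} [Fintype A] [Fintype S] [DecidableEq S]

/-- The state of the reference and the `n` channel inputs after encoding. -/
def encoded (P : Protocol N n A S) : Matrix (A × (Fin n → X)) (A × (Fin n → X)) ℂ :=
  ampliate A P.enc.map (Matrix.vecMulVec P.φ (star P.φ))

/-- The state of the reference and the `n` channel outputs. -/
def received (P : Protocol N n A S) : Matrix (A × (Fin n → Y)) (A × (Fin n → Y)) ℂ :=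
  ampliate A (tensorPower n N.map) P.encoded

/-- The state of the reference and the receiver after decoding. -/
def decoded (P : Protocol N n A S) : Matrix (A × S) (A × S) ℂ :=
  ampliate A P.dec.map P.received

/-- The fidelity `⟨φ| ρ |φ⟩` of the decoded state `ρ` with the original state `φ`. -/
noncomputable def fidelity (P : Protocol N n A S) : ℝ :=
  (star P.φ ⬝ᵥ P.decoded.mulVec P.φ).re

/-- `P` is an `(n, R, ε)` code: its communication rate `ln |S| / n` is `R`, and its fidelity is
not smaller than `1 - ε`. -/
def IsCode (P : Protocol N n A S) (R ε : ℝ) : Prop :=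
  R = Real.log (Fintype.card S) / n ∧ 1 - ε ≤ P.fidelity

end Protocol

end QInfo

/- A test on the decoded state, which consists of the projection onto `φ` and of the rest of
`supp ρ^A ⊗ S`, turns `ρ^{AB^n}` into the pair `(f, 1 - f)`, where `f` is the fidelity, and
`𝟙 ⊗ σ^{B^n}` into `(1/|S|, |S| - 1/|S|)`. Decoding followed by the test is a measurement of
`A B^n`, and a measurement cannot increase the Petz divergence of order `1 < λ ≤ 2`: the divergence
of two matrices is that of their Nussbaum–Szkoła distributions, `x^λ y^(1-λ)` is a mixture of the
quadratic perspectives `x² / (a x + b y)`, and for those the claim follows from a variational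
formula and Kadison's inequality. Hence `𝔻_λ(f ‖ 1/|S|) ≤ K_λ(A⟩B^n)`, and the left side increases
with `f` beyond `1/|S|²`. Keeping only its first term on the left, and on the right the state `σ`
that is optimal by Sibson's identity, gives the bound with `E₀` for `λ = 1/(s+1)`. -/

namespace QInfo

open scoped ComplexOrder Kronecker
open Matrix MeasureTheory

section Perspective

theorem exists_measure_rpow_mul_rpow_eq_integral {lam : ℝ} (h1 : 1 < lam) (h2 : lam < 2) :
    ∃ μ : Measure ℝ, ∀ x y : ℝ, 0 ≤ x → 0 ≤ y → (y = 0 → x = 0) →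
      IntegrableOn (fun t ↦ t ^ (lam - 2) * (x ^ 2 / (x + t * y))) (Set.Ioi 0) μ ∧
      x ^ lam * y ^ (1 - lam) =
        ∫ t in Set.Ioi 0, t ^ (lam - 2) * (x ^ 2 / (x + t * y)) ∂μ := by
  have hl : lam - 1 ∈ Set.Ioo (0 : ℝ) 1 := ⟨by linarith, by linarith⟩
  obtain ⟨μ, hμ⟩ := Real.exists_measure_rpow_eq_integral_rpowIntegrand₀₁ hl
  refine ⟨μ, fun x y hx hy hxy ↦ ?_⟩
  have hcongr : Set.EqOn (fun t ↦ x * Real.rpowIntegrand₀₁ (lam - 1) t (x / y))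
      (fun t ↦ t ^ (lam - 2) * (x ^ 2 / (x + t * y))) (Set.Ioi 0) := by
    intro t ht
    have ht : 0 < t := ht
    rcases hy.eq_or_lt with hy | hy
    · simp [hxy hy.symm]
    · have hlam : lam - 1 - 1 = lam - 2 := by ring
      simp only [Real.rpowIntegrand₀₁_eq_pow_div hl ht.le (div_nonneg hx hy.le), hlam]
      have : 0 < t + x / y := by positivity
      have : 0 < x + t * y := by positivity
      field_simp
      ring
  obtain ⟨hint, hpow⟩ := hμ _ (div_nonneg hx hy)
  refine ⟨IntegrableOn.congr_fun (hint.const_mul x) hcongr measurableSet_Ioi, ?_⟩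
  rw [← setIntegral_congr_fun measurableSet_Ioi hcongr, integral_const_mul, ← hpow,
    Real.div_rpow hx hy, div_eq_mul_inv, ← Real.rpow_neg hy, neg_sub, ← mul_assoc,
    ← Real.rpow_one_add' hx (by linarith), add_sub_cancel]

/- The powers `x ^ lam * y ^ (1 - lam)` with `1 < lam < 2` are mixtures of the quadratic
perspectives `x ^ 2 / (x + t * y)`, and `lam = 2` is the case `a = 0`. -/
theorem sum_rpow_mul_rpow_le {ι κ : Type*} [Fintype ι] [Fintype κ] {p q : ι → ℝ} {r s : κ → ℝ}
    (hp : ∀ i, 0 ≤ p i) (hq : ∀ i, 0 ≤ q i) (hpq : ∀ i, q i = 0 → p i = 0)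
    (hr : ∀ k, 0 ≤ r k) (hs : ∀ k, 0 ≤ s k) (hrs : ∀ k, s k = 0 → r k = 0)
    (h : ∀ a b : ℝ, 0 ≤ a → 0 < b →
      ∑ i, p i ^ 2 / (a * p i + b * q i) ≤ ∑ k, r k ^ 2 / (a * r k + b * s k))
    {lam : ℝ} (h1 : 1 < lam) (h2 : lam ≤ 2) :
    ∑ i, p i ^ lam * q i ^ (1 - lam) ≤ ∑ k, r k ^ lam * s k ^ (1 - lam) := by
  rcases h2.eq_or_lt with rfl | h2
  · have hexp : (1 : ℝ) - 2 = -1 := by norm_num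
    simpa only [zero_mul, one_mul, zero_add, hexp, Real.rpow_neg_one, Real.rpow_two,
      div_eq_mul_inv] using h 0 1 le_rfl one_pos
  · obtain ⟨μ, hμ⟩ := exists_measure_rpow_mul_rpow_eq_integral h1 h2
    have hP i := hμ (p i) (q i) (hp i) (hq i) (hpq i)
    have hR k := hμ (r k) (s k) (hr k) (hs k) (hrs k)
    simp_rw [fun i ↦ (hP i).2, fun k ↦ (hR k).2]
    rw [← integral_finsetSum _ fun i _ ↦ (hP i).1, ← integral_finsetSum _ fun k _ ↦ (hR k).1]
    refine setIntegral_mono_on (integrable_finsetSum _ fun i _ ↦ (hP i).1)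
      (integrable_finsetSum _ fun k _ ↦ (hR k).1) measurableSet_Ioi fun t ht ↦ ?_
    rw [← Finset.mul_sum, ← Finset.mul_sum]
    simpa only [one_mul] using mul_le_mul_of_nonneg_left (h 1 t zero_le_one ht)
      (Real.rpow_nonneg (Set.mem_Ioi.1 ht).le (lam - 2))

theorem monotoneOn_rpow_mul_add_rpow_mul {b c lam : ℝ} (hb : 0 < b) (hc : 0 ≤ c)
    (hlam : 1 ≤ lam) :
    MonotoneOn (fun x : ℝ ↦ x ^ lam * b ^ (1 - lam) + (1 - x) ^ lam * c ^ (1 - lam))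
      (Set.Icc (b / (b + c)) 1) := by
  have hderiv (x : ℝ) : HasDerivAt
      (fun x : ℝ ↦ x ^ lam * b ^ (1 - lam) + (1 - x) ^ lam * c ^ (1 - lam))
      (lam * x ^ (lam - 1) * b ^ (1 - lam) + -1 * lam * (1 - x) ^ (lam - 1) * c ^ (1 - lam))
      x :=
    ((Real.hasDerivAt_rpow_const (Or.inr hlam)).mul_const _).add
      ((((hasDerivAt_id x).const_sub 1).rpow_const (Or.inr hlam)).mul_const _)
  refine monotoneOn_of_deriv_nonneg (convex_Icc _ _)
    (fun x _ ↦ (hderiv x).continuousAt.continuousWithinAt)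
    (fun x _ ↦ (hderiv x).differentiableAt.differentiableWithinAt) fun x hx ↦ ?_
  rw [interior_Icc] at hx
  have hx0 : 0 < x := lt_of_le_of_lt (by positivity) hx.1
  have hxb := (div_lt_iff₀ (by positivity)).1 hx.1
  have hratio : (1 - x) / c ≤ x / b := by
    rcases hc.eq_or_lt with rfl | hc
    · rw [div_zero]
      positivity
    · rw [div_le_div_iff₀ hc hb]
      linarith
  have hswap (y z : ℝ) (hy : 0 ≤ y) (hz : 0 ≤ z) :
      (y / z) ^ (lam - 1) = y ^ (lam - 1) * z ^ (1 - lam) := by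
    rw [Real.div_rpow hy hz, div_eq_mul_inv, ← Real.rpow_neg hz, neg_sub]
  have hpow := Real.rpow_le_rpow (div_nonneg (sub_nonneg.2 hx.2.le) hc) hratio
    (sub_nonneg.2 hlam)
  rw [hswap x b hx0.le hb.le, hswap (1 - x) c (sub_nonneg.2 hx.2.le) hc] at hpow
  rw [(hderiv x).deriv]
  linear_combination lam * hpow

end Perspective

section PosSemidef

lemma conjTranspose_sum_real_smul {m ι : Type*} {s : Finset ι} {Q : ι → Matrix m m ℂ}
    (hQ : ∀ k, (Q k).IsHermitian) (x : ι → ℝ) : (∑ k ∈ s, x k • Q k)ᴴ = ∑ k ∈ s, x k • Q k := by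
  simp only [conjTranspose_sum, conjTranspose_smul, (hQ _).eq, star_trivial]

variable {m : Type*} [Fintype m]

open scoped MatrixOrder in
lemma exists_eq_conjTranspose_mul_self {A : Matrix m m ℂ} (hA : A.PosSemidef) :
    ∃ B : Matrix m m ℂ, A = Bᴴ * B := by
  classical
  exact CStarAlgebra.nonneg_iff_eq_star_mul_self.mp hA.nonneg

lemma trace_mul_nonneg {A B : Matrix m m ℂ} (hA : A.PosSemidef) (hB : B.PosSemidef) :
    0 ≤ (A * B).trace := by
  obtain ⟨C, rfl⟩ := exists_eq_conjTranspose_mul_self hA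
  rw [trace_mul_cycle, trace_mul_cycle]
  exact (hB.mul_mul_conjTranspose_same C).trace_nonneg

lemma trace_mul_re_nonneg {A B : Matrix m m ℂ} (hA : A.PosSemidef) (hB : B.PosSemidef) :
    0 ≤ (A * B).trace.re :=
  (Complex.nonneg_iff.1 (trace_mul_nonneg hA hB)).1

lemma ofReal_trace_mul_re {A B : Matrix m m ℂ} (hA : A.PosSemidef) (hB : B.PosSemidef) :
    ((A * B).trace.re : ℂ) = (A * B).trace :=
  (Complex.eq_re_of_ofReal_le (r := 0) (by simpa using trace_mul_nonneg hA hB)).symm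

lemma mul_eq_zero_of_trace_mul_re_eq_zero {A B : Matrix m m ℂ} (hA : A.PosSemidef)
    (hB : B.PosSemidef) (h : (A * B).trace.re = 0) : A * B = 0 := by
  have htr : (A * B).trace = 0 := by rw [← ofReal_trace_mul_re hA hB, h, Complex.ofReal_zero]
  obtain ⟨C, rfl⟩ := exists_eq_conjTranspose_mul_self hA
  obtain ⟨D, rfl⟩ := exists_eq_conjTranspose_mul_self hB
  have hCD : C * Dᴴ = 0 := by
    rw [← trace_conjTranspose_mul_self_eq_zero_iff, ← htr, conjTranspose_mul,
      conjTranspose_conjTranspose, Matrix.mul_assoc, trace_mul_comm]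
    simp only [Matrix.mul_assoc]
  rw [Matrix.mul_assoc, ← Matrix.mul_assoc C, hCD, Matrix.zero_mul, Matrix.mul_zero]

lemma mul_eq_zero_of_ker_le {ρ σ : Matrix m m ℂ}
    (hsupp : ∀ v : m → ℂ, σ.mulVec v = 0 → ρ.mulVec v = 0) {n : Type*} {B : Matrix m n ℂ}
    (hB : σ * B = 0) : ρ * B = 0 :=
  ext_col fun j ↦ hsupp (B.col j) (congrArg (·.col j) hB)

lemma trace_mul_re_eq_zero_of_ker_le {ρ σ Q : Matrix m m ℂ} (hσ : σ.PosSemidef)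
    (hsupp : ∀ v : m → ℂ, σ.mulVec v = 0 → ρ.mulVec v = 0) (hQ : Q.PosSemidef)
    (h : (σ * Q).trace.re = 0) : (ρ * Q).trace.re = 0 := by
  rw [mul_eq_zero_of_ker_le hsupp (mul_eq_zero_of_trace_mul_re_eq_zero hσ hQ h), trace_zero,
    Complex.zero_re]

lemma trace_mul_sum_real_smul_re {ι : Type*} {s : Finset ι} (A : Matrix m m ℂ)
    (x : ι → ℝ) (Q : ι → Matrix m m ℂ) :
    (A * ∑ k ∈ s, x k • Q k).trace.re = ∑ k ∈ s, x k * (A * Q k).trace.re := by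
  simp only [Finset.mul_sum, trace_sum, Complex.re_sum, mul_smul_comm, trace_smul,
    Complex.real_smul, Complex.re_ofReal_mul]

/- Kadison's inequality for the measurement `Q`: the difference is
`∑ k, (x k - X) * Q k * (x k - X) + X * (1 - ∑ k, Q k) * X` with `X = ∑ k, x k • Q k`. -/
lemma posSemidef_sum_sq_smul_sub_sq [DecidableEq m] {ι : Type*} [Fintype ι]
    {Q : ι → Matrix m m ℂ} (hQ : ∀ k, (Q k).PosSemidef) (hQ1 : (1 - ∑ k, Q k).PosSemidef)
    (x : ι → ℝ) :
    (∑ k, (x k ^ 2) • Q k - (∑ k, x k • Q k) * ∑ k, x k • Q k).PosSemidef := by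
  set X := ∑ k, x k • Q k with hX
  have hXh : Xᴴ = X := conjTranspose_sum_real_smul (fun k ↦ (hQ k).1) x
  have hsq k : (x k • (1 : Matrix m m ℂ) - X)ᴴ * Q k * (x k • (1 : Matrix m m ℂ) - X) =
      (x k ^ 2) • Q k - (x k • Q k) * X - X * (x k • Q k) + X * Q k * X := by
    rw [conjTranspose_sub, conjTranspose_smul, hXh, conjTranspose_one, star_trivial]
    simp only [sub_mul, mul_sub, smul_mul_assoc, mul_smul_comm, one_mul, mul_one, smul_sub,
      smul_smul, pow_two]
    abel
  have key : ∑ k, (x k ^ 2) • Q k - X * X =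
      ∑ k, (x k • (1 : Matrix m m ℂ) - X)ᴴ * Q k * (x k • (1 : Matrix m m ℂ) - X)
        + Xᴴ * (1 - ∑ k, Q k) * X := by
    simp_rw [hsq, Finset.sum_add_distrib, Finset.sum_sub_distrib, ← Finset.sum_mul,
      ← Finset.mul_sum, ← hX, hXh]
    noncomm_ring
  rw [key]
  exact (posSemidef_sum _ fun k _ ↦ (hQ k).conjTranspose_mul_mul_same _).add
    (hQ1.conjTranspose_mul_mul_same X)

end PosSemidef

section Spectral

variable {m : Type*} [Fintype m] [DecidableEq m] {ρ σ : Matrix m m ℂ}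

/-- The matrix of `X` with respect to the eigenbases of `σ` (columns) and of `ρ` (rows). -/
noncomputable def eigenMatrix (hρ : ρ.IsHermitian) (hσ : σ.IsHermitian) (X : Matrix m m ℂ) :
    Matrix m m ℂ :=
  (hρ.eigenvectorUnitary : Matrix m m ℂ)ᴴ * X * (hσ.eigenvectorUnitary : Matrix m m ℂ)

lemma eigenMatrix_cfc_mul_apply (hρ : ρ.IsHermitian) (hσ : σ.IsHermitian) (f : ℝ → ℝ)
    (X : Matrix m m ℂ) (i j : m) :
    eigenMatrix hρ hσ (cfc f ρ * X) i j = f (hρ.eigenvalues i) * eigenMatrix hρ hσ X i j := by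
  have hU : (hρ.eigenvectorUnitary : Matrix m m ℂ)ᴴ * hρ.eigenvectorUnitary = 1 :=
    Unitary.coe_star_mul_self _
  have hf : cfc f ρ = (hρ.eigenvectorUnitary : Matrix m m ℂ) *
      (diagonal (fun i ↦ (f (hρ.eigenvalues i) : ℂ)) *
        (hρ.eigenvectorUnitary : Matrix m m ℂ)ᴴ) := by
    rw [hρ.cfc_eq, ← Matrix.mul_assoc]
    rfl
  have : eigenMatrix hρ hσ (cfc f ρ * X) =
      diagonal (fun i ↦ (f (hρ.eigenvalues i) : ℂ)) * eigenMatrix hρ hσ X := by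
    simp only [eigenMatrix, hf, ← Matrix.mul_assoc, hU, Matrix.one_mul]
  rw [this, diagonal_mul]

lemma conjTranspose_eigenMatrix (hρ : ρ.IsHermitian) (hσ : σ.IsHermitian) (X : Matrix m m ℂ) :
    (eigenMatrix hρ hσ X)ᴴ = eigenMatrix hσ hρ Xᴴ := by
  simp only [eigenMatrix, conjTranspose_mul, conjTranspose_conjTranspose, Matrix.mul_assoc]

lemma eigenMatrix_mul_cfc_apply (hρ : ρ.IsHermitian) (hσ : σ.IsHermitian) (f : ℝ → ℝ)
    (X : Matrix m m ℂ) (i j : m) :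
    eigenMatrix hρ hσ (X * cfc f σ) i j = eigenMatrix hρ hσ X i j * f (hσ.eigenvalues j) := by
  have hf : (cfc f σ)ᴴ = cfc f σ := cfc_predicate f σ
  rw [← conjTranspose_conjTranspose (eigenMatrix hρ hσ (X * cfc f σ)), conjTranspose_eigenMatrix,
    conjTranspose_mul, hf, conjTranspose_apply, eigenMatrix_cfc_mul_apply,
    ← conjTranspose_eigenMatrix, conjTranspose_apply, star_mul', star_star, mul_comm]
  simp

lemma eigenMatrix_left_mul_apply (hρ : ρ.IsHermitian) (hσ : σ.IsHermitian) (X : Matrix m m ℂ)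
    (i j : m) : eigenMatrix hρ hσ (ρ * X) i j = hρ.eigenvalues i * eigenMatrix hρ hσ X i j := by
  have hid : cfc (fun x : ℝ ↦ x) ρ = ρ := cfc_id' ℝ ρ hρ
  simpa only [hid] using eigenMatrix_cfc_mul_apply hρ hσ (fun x ↦ x) X i j

lemma eigenMatrix_mul_right_apply (hρ : ρ.IsHermitian) (hσ : σ.IsHermitian) (X : Matrix m m ℂ)
    (i j : m) : eigenMatrix hρ hσ (X * σ) i j = eigenMatrix hρ hσ X i j * hσ.eigenvalues j := by
  have hid : cfc (fun x : ℝ ↦ x) σ = σ := cfc_id' ℝ σ hσ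
  simpa only [hid] using eigenMatrix_mul_cfc_apply hρ hσ (fun x ↦ x) X i j

lemma trace_mul_conjTranspose_eq_sum_eigenMatrix (hρ : ρ.IsHermitian) (hσ : σ.IsHermitian)
    (X Y : Matrix m m ℂ) :
    (X * Yᴴ).trace =
      ∑ x : m × m, eigenMatrix hρ hσ X x.1 x.2 * star (eigenMatrix hρ hσ Y x.1 x.2) := by
  set U : Matrix m m ℂ := ↑hρ.eigenvectorUnitary with hU
  set W : Matrix m m ℂ := ↑hσ.eigenvectorUnitary with hW
  have hUU : U * Uᴴ = 1 := Unitary.coe_mul_star_self _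
  have hWW : W * Wᴴ = 1 := Unitary.coe_mul_star_self _
  calc (X * Yᴴ).trace = (U * Uᴴ * X * (W * Wᴴ) * Yᴴ).trace := by
        rw [hUU, hWW, Matrix.one_mul, Matrix.mul_one]
    _ = (eigenMatrix hρ hσ X * (eigenMatrix hρ hσ Y)ᴴ).trace := by
        rw [conjTranspose_eigenMatrix, eigenMatrix, eigenMatrix, ← hU, ← hW, Matrix.mul_assoc,
          Matrix.mul_assoc U, Matrix.mul_assoc U, trace_mul_comm]
        simp only [Matrix.mul_assoc]
    _ = _ := by
        simp only [trace, diag_apply, mul_apply, conjTranspose_apply, Fintype.sum_prod_type]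

lemma eigenvalues_mul_eigenMatrix_one_eq_zero (hρ : ρ.IsHermitian) (hσ : σ.IsHermitian)
    (hsupp : ∀ v : m → ℂ, σ.mulVec v = 0 → ρ.mulVec v = 0) {i j : m}
    (hj : hσ.eigenvalues j = 0) :
    (hρ.eigenvalues i : ℂ) * eigenMatrix hρ hσ 1 i j = 0 := by
  have hker : ρ.mulVec (hσ.eigenvectorBasis j) = 0 :=
    hsupp _ (by rw [hσ.mulVec_eigenvectorBasis, hj, zero_smul])
  rw [← eigenMatrix_left_mul_apply hρ hσ, Matrix.mul_one, eigenMatrix,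
    Matrix.mul_assoc, mul_apply]
  exact Finset.sum_eq_zero fun k _ ↦ mul_eq_zero_of_right _ (congrFun hker k)

/-- The first of the two Nussbaum–Szkoła distributions of `ρ` and `σ`, the classical distributions
`r i * |⟨e i, f j⟩| ^ 2` and `s j * |⟨e i, f j⟩| ^ 2` with the same Rényi divergences as `ρ` and
`σ`, where `r`, `s` are the eigenvalues and `e`, `f` the eigenbases. -/
noncomputable def nussbaumSzkolaFst (hρ : ρ.IsHermitian) (hσ : σ.IsHermitian) (x : m × m) : ℝ :=
  hρ.eigenvalues x.1 * Complex.normSq (eigenMatrix hρ hσ 1 x.1 x.2)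

/-- The second of the two Nussbaum–Szkoła distributions of `ρ` and `σ`. -/
noncomputable def nussbaumSzkolaSnd (hρ : ρ.IsHermitian) (hσ : σ.IsHermitian) (x : m × m) : ℝ :=
  hσ.eigenvalues x.2 * Complex.normSq (eigenMatrix hρ hσ 1 x.1 x.2)

lemma nussbaumSzkolaFst_nonneg (hρ : ρ.PosSemidef) (hσ : σ.IsHermitian) (x : m × m) :
    0 ≤ nussbaumSzkolaFst hρ.1 hσ x :=
  mul_nonneg (hρ.eigenvalues_nonneg _) (Complex.normSq_nonneg _)

lemma nussbaumSzkolaSnd_nonneg (hρ : ρ.IsHermitian) (hσ : σ.PosSemidef) (x : m × m) :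
    0 ≤ nussbaumSzkolaSnd hρ hσ.1 x :=
  mul_nonneg (hσ.eigenvalues_nonneg _) (Complex.normSq_nonneg _)

lemma nussbaumSzkolaFst_eq_zero (hρ : ρ.IsHermitian) (hσ : σ.IsHermitian)
    (hsupp : ∀ v : m → ℂ, σ.mulVec v = 0 → ρ.mulVec v = 0) {x : m × m}
    (hx : nussbaumSzkolaSnd hρ hσ x = 0) : nussbaumSzkolaFst hρ hσ x = 0 := by
  rcases mul_eq_zero.1 hx with hs | ho
  · rcases mul_eq_zero.1 (eigenvalues_mul_eigenMatrix_one_eq_zero hρ hσ hsupp hs) with hr | ho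
    · rw [nussbaumSzkolaFst, Complex.ofReal_eq_zero.1 hr, zero_mul]
    · rw [nussbaumSzkolaFst, ho, map_zero, mul_zero]
  · rw [nussbaumSzkolaFst, ho, mul_zero]

lemma rpow_mul_rpow_one_sub_normSq {r s : ℝ} (hr : 0 ≤ r) (hs : 0 ≤ s) (o : ℂ) (lam : ℝ) :
    (r * Complex.normSq o) ^ lam * (s * Complex.normSq o) ^ (1 - lam) =
      (((r ^ lam : ℝ) : ℂ) * (o * ((s ^ (1 - lam) : ℝ) : ℂ)) * star o).re := by
  have ho := Complex.normSq_nonneg o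
  have hpow : Complex.normSq o ^ lam * Complex.normSq o ^ (1 - lam) = Complex.normSq o := by
    rw [← Real.rpow_add' ho (by simp), add_sub_cancel, Real.rpow_one]
  rw [Real.mul_rpow hr ho, Real.mul_rpow hs ho, mul_mul_mul_comm, hpow, mul_assoc (_ : ℂ),
    mul_right_comm o, RCLike.star_def, Complex.mul_conj, ← Complex.ofReal_mul,
    ← Complex.ofReal_mul, Complex.ofReal_re]
  ring

lemma trace_mpow_mul_mpow_re_eq_sum (hρ : ρ.PosSemidef) (hσ : σ.PosSemidef) (lam : ℝ) :
    (mpow ρ lam * mpow σ (1 - lam)).trace.re =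
      ∑ x, nussbaumSzkolaFst hρ.1 hσ.1 x ^ lam * nussbaumSzkolaSnd hρ.1 hσ.1 x ^ (1 - lam) := by
  have htr := trace_mul_conjTranspose_eq_sum_eigenMatrix hρ.1 hσ.1
    (mpow ρ lam * (1 * mpow σ (1 - lam))) 1
  rw [conjTranspose_one, Matrix.mul_one, Matrix.one_mul] at htr
  rw [htr, Complex.re_sum]
  refine Finset.sum_congr rfl fun x _ ↦ ?_
  rw [nussbaumSzkolaFst, nussbaumSzkolaSnd, rpow_mul_rpow_one_sub_normSq
    (hρ.eigenvalues_nonneg _) (hσ.eigenvalues_nonneg _), ← Matrix.one_mul (mpow σ (1 - lam)),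
    mpow, mpow, eigenMatrix_cfc_mul_apply, eigenMatrix_mul_cfc_apply]

lemma two_mul_re_sub_le_sq_div {c r : ℝ} (hc : 0 ≤ c) {o y : ℂ}
    (h0 : c * Complex.normSq o = 0 → r * Complex.normSq o = 0) :
    2 * (r * (o * star y).re) - c * Complex.normSq y ≤
      (r * Complex.normSq o) ^ 2 / (c * Complex.normSq o) := by
  rcases eq_or_ne o 0 with rfl | ho
  · have := mul_nonneg hc (Complex.normSq_nonneg y)
    simpa
  have ho' := Complex.normSq_pos.2 ho
  rcases hc.eq_or_lt with rfl | hc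
  · have hr : r = 0 := (mul_eq_zero.1 (h0 (zero_mul _))).resolve_right ho'.ne'
    simp [hr]
  · have hsq := Complex.normSq_nonneg (r * o - c * y)
    rw [show (r * Complex.normSq o) ^ 2 / (c * Complex.normSq o) =
      r ^ 2 * Complex.normSq o / c by field_simp, le_div_iff₀ hc]
    rw [Complex.normSq_sub, map_mul, map_mul, Complex.normSq_ofReal, Complex.normSq_ofReal,
      map_mul, Complex.conj_ofReal] at hsq
    have : ((r : ℂ) * o * (c * (starRingEnd ℂ) y)).re = r * c * (o * star y).re := by
      rw [mul_mul_mul_comm, ← Complex.ofReal_mul, Complex.re_ofReal_mul, RCLike.star_def]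
    rw [this] at hsq
    linarith

lemma trace_variational_eq_sum (hρ : ρ.IsHermitian) (hσ : σ.IsHermitian) (a b : ℝ)
    (X : Matrix m m ℂ) :
    2 * (ρ * Xᴴ).trace.re - a * (ρ * X * Xᴴ).trace.re - b * (X * σ * Xᴴ).trace.re =
      ∑ x : m × m, (2 * (hρ.eigenvalues x.1 *
        (eigenMatrix hρ hσ 1 x.1 x.2 * star (eigenMatrix hρ hσ X x.1 x.2)).re) -
        (a * hρ.eigenvalues x.1 + b * hσ.eigenvalues x.2) *
          Complex.normSq (eigenMatrix hρ hσ X x.1 x.2)) := by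
  have htr1 : (ρ * Xᴴ).trace.re = ∑ x : m × m, hρ.eigenvalues x.1 *
      (eigenMatrix hρ hσ 1 x.1 x.2 * star (eigenMatrix hρ hσ X x.1 x.2)).re := by
    have h := trace_mul_conjTranspose_eq_sum_eigenMatrix hρ hσ (ρ * 1) X
    rw [Matrix.mul_one] at h
    rw [h, Complex.re_sum]
    refine Finset.sum_congr rfl fun x _ ↦ ?_
    rw [← Complex.re_ofReal_mul, ← mul_assoc, ← eigenMatrix_left_mul_apply, Matrix.mul_one]
  have htr2 : (ρ * X * Xᴴ).trace.re = ∑ x : m × m, hρ.eigenvalues x.1 *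
      Complex.normSq (eigenMatrix hρ hσ X x.1 x.2) := by
    rw [trace_mul_conjTranspose_eq_sum_eigenMatrix hρ hσ, Complex.re_sum]
    simp only [eigenMatrix_left_mul_apply, mul_assoc, RCLike.star_def, Complex.mul_conj,
      ← Complex.ofReal_mul, Complex.ofReal_re]
  have htr3 : (X * σ * Xᴴ).trace.re = ∑ x : m × m, hσ.eigenvalues x.2 *
      Complex.normSq (eigenMatrix hρ hσ X x.1 x.2) := by
    rw [trace_mul_conjTranspose_eq_sum_eigenMatrix hρ hσ, Complex.re_sum]
    refine Finset.sum_congr rfl fun x _ ↦ ?_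
    have hstar (z : ℂ) : z * star z = Complex.normSq z := Complex.mul_conj z
    rw [eigenMatrix_mul_right_apply, mul_right_comm, hstar, mul_comm, Complex.re_ofReal_mul,
      Complex.ofReal_re]
  simp only [htr1, htr2, htr3, Finset.mul_sum, ← Finset.sum_sub_distrib]
  exact Finset.sum_congr rfl fun x _ ↦ by ring

lemma trace_variational_le_sum (hρ : ρ.PosSemidef) (hσ : σ.PosSemidef)
    (hsupp : ∀ v : m → ℂ, σ.mulVec v = 0 → ρ.mulVec v = 0) {a b : ℝ} (ha : 0 ≤ a) (hb : 0 < b)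
    (X : Matrix m m ℂ) :
    2 * (ρ * Xᴴ).trace.re - a * (ρ * X * Xᴴ).trace.re - b * (X * σ * Xᴴ).trace.re ≤
      ∑ x, nussbaumSzkolaFst hρ.1 hσ.1 x ^ 2 /
        (a * nussbaumSzkolaFst hρ.1 hσ.1 x + b * nussbaumSzkolaSnd hρ.1 hσ.1 x) := by
  rw [trace_variational_eq_sum hρ.1 hσ.1]
  refine Finset.sum_le_sum fun x _ ↦ ?_
  have hr := hρ.eigenvalues_nonneg x.1
  have hs := hσ.eigenvalues_nonneg x.2
  have hc : a * nussbaumSzkolaFst hρ.1 hσ.1 x + b * nussbaumSzkolaSnd hρ.1 hσ.1 x =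
      (a * hρ.1.eigenvalues x.1 + b * hσ.1.eigenvalues x.2) *
        Complex.normSq (eigenMatrix hρ.1 hσ.1 1 x.1 x.2) := by
    rw [nussbaumSzkolaFst, nussbaumSzkolaSnd]
    ring
  rw [hc]
  refine two_mul_re_sub_le_sq_div (by positivity) fun h0 ↦
    nussbaumSzkolaFst_eq_zero hρ.1 hσ.1 hsupp ?_
  have hfst := nussbaumSzkolaFst_nonneg hρ hσ.1 x
  have hsnd := nussbaumSzkolaSnd_nonneg hρ.1 hσ x
  rw [← hc, add_eq_zero_iff_of_nonneg (by positivity) (by positivity)] at h0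
  exact (mul_eq_zero.1 h0.2).resolve_left hb.ne'

variable {ι : Type*} [Fintype ι] {Q : ι → Matrix m m ℂ}

/- With `x k = p k / (a * p k + b * q k)` the left hand side is
`∑ k, (2 * x k * p k - a * x k ^ 2 * p k - b * x k ^ 2 * q k)`, and by Kadison's inequality it is
at most the variational expression at the observable `∑ k, x k • Q k`. -/
lemma sum_sq_div_measurement_le (hρ : ρ.PosSemidef) (hσ : σ.PosSemidef)
    (hsupp : ∀ v : m → ℂ, σ.mulVec v = 0 → ρ.mulVec v = 0) (hQ : ∀ k, (Q k).PosSemidef)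
    (hQ1 : (1 - ∑ k, Q k).PosSemidef) {a b : ℝ} (ha : 0 ≤ a) (hb : 0 < b) :
    ∑ k, (ρ * Q k).trace.re ^ 2 / (a * (ρ * Q k).trace.re + b * (σ * Q k).trace.re) ≤
      ∑ x, nussbaumSzkolaFst hρ.1 hσ.1 x ^ 2 /
        (a * nussbaumSzkolaFst hρ.1 hσ.1 x + b * nussbaumSzkolaSnd hρ.1 hσ.1 x) := by
  set p : ι → ℝ := fun k ↦ (ρ * Q k).trace.re
  set q : ι → ℝ := fun k ↦ (σ * Q k).trace.re
  set x : ι → ℝ := fun k ↦ p k / (a * p k + b * q k)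
  have hX : (∑ k, x k • Q k)ᴴ = ∑ k, x k • Q k := conjTranspose_sum_real_smul (fun k ↦ (hQ k).1) x
  have hkadison {τ : Matrix m m ℂ} (hτ : τ.PosSemidef) :
      (τ * ((∑ k, x k • Q k) * ∑ k, x k • Q k)).trace.re ≤
        ∑ k, x k ^ 2 * (τ * Q k).trace.re := by
    have h := trace_mul_re_nonneg hτ (posSemidef_sum_sq_smul_sub_sq hQ hQ1 x)
    rwa [mul_sub, trace_sub, Complex.sub_re, trace_mul_sum_real_smul_re, sub_nonneg] at h
  have hvar := trace_variational_le_sum hρ hσ hsupp ha hb (∑ k, x k • Q k)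
  rw [hX, trace_mul_sum_real_smul_re, Matrix.mul_assoc ρ, trace_mul_cycle _ σ, trace_mul_comm _ σ]
    at hvar
  have hx k : p k ^ 2 / (a * p k + b * q k) =
      2 * (x k * p k) - (a * (x k ^ 2 * p k) + b * (x k ^ 2 * q k)) := by
    rcases eq_or_ne (a * p k + b * q k) 0 with hc | hc
    · have : x k = 0 := by rw [show x k = p k / (a * p k + b * q k) from rfl, hc, div_zero]
      rw [hc, this]
      simp
    · have : x k * (a * p k + b * q k) = p k := div_mul_cancel₀ _ hc
      rw [div_eq_iff hc]
      linear_combination (x k * (a * p k + b * q k) - p k) * this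
  refine (Finset.sum_congr rfl fun k _ ↦ hx k).trans_le (le_trans ?_ hvar)
  simp only [Finset.sum_sub_distrib, Finset.sum_add_distrib, ← Finset.mul_sum]
  linarith [mul_le_mul_of_nonneg_left (hkadison hρ) ha,
    mul_le_mul_of_nonneg_left (hkadison hσ) hb.le]

theorem sum_trace_mul_rpow_le (hρ : ρ.PosSemidef) (hσ : σ.PosSemidef)
    (hsupp : ∀ v : m → ℂ, σ.mulVec v = 0 → ρ.mulVec v = 0) (hQ : ∀ k, (Q k).PosSemidef)
    (hQ1 : (1 - ∑ k, Q k).PosSemidef) {lam : ℝ} (h1 : 1 < lam) (h2 : lam ≤ 2) :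
    ∑ k, (ρ * Q k).trace.re ^ lam * (σ * Q k).trace.re ^ (1 - lam) ≤
      (mpow ρ lam * mpow σ (1 - lam)).trace.re := by
  rw [trace_mpow_mul_mpow_re_eq_sum hρ hσ]
  exact sum_rpow_mul_rpow_le
    (fun k ↦ trace_mul_re_nonneg hρ (hQ k)) (fun k ↦ trace_mul_re_nonneg hσ (hQ k))
    (fun k ↦ trace_mul_re_eq_zero_of_ker_le hσ hsupp (hQ k))
    (nussbaumSzkolaFst_nonneg hρ hσ.1) (nussbaumSzkolaSnd_nonneg hρ.1 hσ)
    (fun _ ↦ nussbaumSzkolaFst_eq_zero hρ.1 hσ.1 hsupp)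
    (fun _ _ ↦ sum_sq_div_measurement_le hρ hσ hsupp hQ hQ1) h1 h2

end Spectral

section Channels

variable {r a b κ : Type*}

lemma ampliate_one_kronecker [DecidableEq r] (Φ : Matrix a a ℂ →ₗ[ℂ] Matrix b b ℂ)
    (σ : Matrix a a ℂ) :
    ampliate r Φ ((1 : Matrix r r ℂ) ⊗ₖ σ) = (1 : Matrix r r ℂ) ⊗ₖ Φ σ := by
  ext ⟨p, u⟩ ⟨q, v⟩
  exact congrFun₂ (Φ.map_smul ((1 : Matrix r r ℂ) p q) σ) u v

variable [Fintype a] [Fintype κ]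

/-- The completely positive map `M ↦ ∑ j, K j * M * (K j)ᴴ` with Kraus operators `K`. The map for
the adjoint operators `(K j)ᴴ` is its adjoint, the map in the Heisenberg picture. -/
def krausMap (K : κ → Matrix b a ℂ) : Matrix a a ℂ →ₗ[ℂ] Matrix b b ℂ :=
  ∑ j, mulRightLinearMap b ℂ (K j)ᴴ ∘ₗ mulLeftLinearMap a ℂ (K j)

lemma krausMap_apply (K : κ → Matrix b a ℂ) (M : Matrix a a ℂ) :
    krausMap K M = ∑ j, K j * M * (K j)ᴴ := by
  simp only [krausMap, LinearMap.sum_apply, LinearMap.comp_apply, mulRightLinearMap_apply,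
    mulLeftLinearMap_apply]

lemma krausMap_single_apply [DecidableEq a] (K : κ → Matrix b a ℂ) (x y : a) (u v : b) :
    krausMap K (single x y 1) u v = ∑ j, K j u x * star (K j v y) := by
  simp [krausMap_apply, Matrix.sum_apply, mul_apply, single_apply, ite_and]

lemma eq_krausMap_of_single [DecidableEq a] {Φ : Matrix a a ℂ →ₗ[ℂ] Matrix b b ℂ}
    {K : κ → Matrix b a ℂ}
    (h : ∀ x y u v, Φ (single x y 1) u v = ∑ j, K j u x * star (K j v y)) :
    Φ = krausMap K := by
  refine ext_linearMap ℂ fun x y ↦ LinearMap.ext_ring ?_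
  ext u v
  exact (h x y u v).trans (krausMap_single_apply K x y u v).symm

lemma posSemidef_krausMap [Finite b] (K : κ → Matrix b a ℂ) {M : Matrix a a ℂ}
    (hM : M.PosSemidef) : (krausMap K M).PosSemidef := by
  rw [krausMap_apply]
  exact posSemidef_sum _ fun j _ ↦ hM.mul_mul_conjTranspose_same _

lemma trace_krausMap_mul [Fintype b] (K : κ → Matrix b a ℂ) (M : Matrix a a ℂ)
    (E : Matrix b b ℂ) :
    (krausMap K M * E).trace = (M * krausMap (fun j ↦ (K j)ᴴ) E).trace := by
  simp only [krausMap_apply, Finset.sum_mul, Finset.mul_sum, trace_sum, conjTranspose_conjTranspose]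
  refine Finset.sum_congr rfl fun j _ ↦ ?_
  rw [Matrix.mul_assoc, Matrix.mul_assoc, trace_mul_comm]
  simp only [Matrix.mul_assoc]

lemma ampliate_krausMap [Fintype r] [DecidableEq r] (K : κ → Matrix b a ℂ) :
    ampliate r (krausMap K) = krausMap fun j ↦ (1 : Matrix r r ℂ) ⊗ₖ K j := by
  refine LinearMap.ext fun M ↦ ?_
  ext ⟨p, u⟩ ⟨q, v⟩
  change krausMap K (of fun i j ↦ M (p, i) (q, j)) u v = _
  simp [krausMap_apply, Matrix.sum_apply, mul_apply, Fintype.sum_prod_type, one_apply,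
    apply_ite (starRingEnd ℂ), Finset.sum_ite_irrel]

lemma trace_kronecker_one_mul [Fintype r] [DecidableEq a] (G : Matrix r r ℂ)
    (M : Matrix (r × a) (r × a) ℂ) :
    ((G ⊗ₖ (1 : Matrix a a ℂ)) * M).trace =
      ∑ x, ∑ y, G x y * (of fun i j ↦ M (y, i) (x, j)).trace := by
  simp only [trace, diag_apply, mul_apply, kroneckerMap_apply, Fintype.sum_prod_type, one_apply,
    mul_ite, mul_one, mul_zero, ite_mul, zero_mul, Finset.sum_ite_eq, Finset.mem_univ, if_true,
    of_apply, Finset.mul_sum]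
  exact Finset.sum_congr rfl fun x _ ↦ Finset.sum_comm

lemma trace_kronecker_one_mul_ampliate [Fintype r] [Fintype b] [DecidableEq a] [DecidableEq b]
    {Φ : Matrix a a ℂ →ₗ[ℂ] Matrix b b ℂ} (hΦ : ∀ M, (Φ M).trace = M.trace) (G : Matrix r r ℂ)
    (M : Matrix (r × a) (r × a) ℂ) :
    ((G ⊗ₖ (1 : Matrix b b ℂ)) * ampliate r Φ M).trace =
      ((G ⊗ₖ (1 : Matrix a a ℂ)) * M).trace := by
  rw [trace_kronecker_one_mul, trace_kronecker_one_mul]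
  refine Finset.sum_congr rfl fun x _ ↦ Finset.sum_congr rfl fun y _ ↦ ?_
  rw [← hΦ]
  rfl

lemma trace_ampliate [Fintype r] [Fintype b] {Φ : Matrix a a ℂ →ₗ[ℂ] Matrix b b ℂ}
    (hΦ : ∀ M, (Φ M).trace = M.trace) (M : Matrix (r × a) (r × a) ℂ) :
    (ampliate r Φ M).trace = M.trace := by
  classical
  simpa only [one_kronecker_one, Matrix.one_mul] using
    trace_kronecker_one_mul_ampliate hΦ (1 : Matrix r r ℂ) M

variable [DecidableEq a]

lemma tensorPower_single (n : ℕ) (Φ : Matrix a a ℂ →ₗ[ℂ] Matrix b b ℂ) (x y : Fin n → a)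
    (u v : Fin n → b) : tensorPower n Φ (single x y 1) u v =
      ∏ k, Φ (single (x k) (y k) 1) (u k) (v k) := by
  simp only [tensorPower, LinearMap.coe_mk, AddHom.coe_mk, of_apply, single_apply, ite_and,
    ite_mul, one_mul, zero_mul]
  rw [Finset.sum_eq_single x, Finset.sum_eq_single y] <;> simp +contextual [eq_comm]

lemma tensorPower_krausMap (n : ℕ) (K : κ → Matrix b a ℂ) :
    tensorPower n (krausMap K) =
      krausMap fun J : Fin n → κ ↦ of fun u x ↦ ∏ k, K (J k) (u k) (x k) := by
  classical
  refine eq_krausMap_of_single fun x y u v ↦ ?_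
  simp only [tensorPower_single, krausMap_single_apply, Finset.prod_univ_sum,
    Fintype.piFinset_univ, of_apply, star_prod, Finset.prod_mul_distrib]

lemma trace_single_one (x y : a) : (single x y (1 : ℂ)).trace = if x = y then 1 else 0 := by
  split_ifs with h
  · rw [h, trace_single_eq_same]
  · exact trace_single_eq_of_ne _ _ _ h

lemma trace_tensorPower_single [Fintype b] (n : ℕ) (Φ : Matrix a a ℂ →ₗ[ℂ] Matrix b b ℂ)
    (x y : Fin n → a) :
    (tensorPower n Φ (single x y 1)).trace = ∏ k, (Φ (single (x k) (y k) 1)).trace := by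
  classical
  simp only [trace, diag_apply, tensorPower_single, Finset.prod_univ_sum, Fintype.piFinset_univ]

lemma trace_tensorPower [Fintype b] (n : ℕ) {Φ : Matrix a a ℂ →ₗ[ℂ] Matrix b b ℂ}
    (hΦ : ∀ M, (Φ M).trace = M.trace) (M : Matrix (Fin n → a) (Fin n → a) ℂ) :
    (tensorPower n Φ M).trace = M.trace := by
  have h : traceLinearMap _ ℂ ℂ ∘ₗ tensorPower n Φ = traceLinearMap (Fin n → a) ℂ ℂ := by
    refine ext_linearMap ℂ fun x y ↦ LinearMap.ext_ring ?_
    change (tensorPower n Φ (single x y 1)).trace = (single x y 1).trace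
    simp only [trace_tensorPower_single, hΦ, trace_single_one, Finset.prod_ite_zero,
      Finset.prod_const_one, funext_iff, Finset.mem_univ, true_imp_iff]
  exact LinearMap.congr_fun h M

end Channels

namespace Channel

variable {a b : Type*} [Fintype a] [Fintype b]

/- The Choi matrix, the image of an unnormalized maximally entangled state, is positive
semidefinite, and the columns of a square root of it are the Kraus operators. -/
lemma exists_map_eq_krausMap (N : Channel a b) :
    ∃ K : Fin (Fintype.card a) × b → Matrix b a ℂ, N.map = krausMap K := by
  classical
  set e := (Fintype.equivFin a).symm
  set w : Fin (Fintype.card a) × a → ℂ := fun p ↦ if e p.1 = p.2 then 1 else 0 with hw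
  obtain ⟨B, hB⟩ := exists_eq_conjTranspose_mul_self
    (N.completelyPositive _ _ (posSemidef_vecMulVec_self_star w))
  refine ⟨fun j ↦ of fun u x ↦ star (B j (e.symm x, u)),
    eq_krausMap_of_single fun x y u v ↦ ?_⟩
  have hblock : single x y (1 : ℂ) =
      of fun i j ↦ vecMulVec w (star w) (e.symm x, i) (e.symm y, j) := by
    ext i j
    by_cases h1 : x = i <;> by_cases h2 : y = j <;> simp [hw, vecMulVec_apply, h1, h2]
  calc N.map (single x y 1) u v = (Bᴴ * B) (e.symm x, u) (e.symm y, v) := by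
        rw [← hB, hblock]
        rfl
    _ = _ := by simp only [mul_apply, conjTranspose_apply, of_apply, star_star]

lemma posSemidef_map (N : Channel a b) {M : Matrix a a ℂ} (hM : M.PosSemidef) :
    (N.map M).PosSemidef := by
  obtain ⟨K, hK⟩ := N.exists_map_eq_krausMap
  exact hK ▸ posSemidef_krausMap K hM

/-- The channel `id_r ⊗ N` acting on the second part of a joint system. -/
def ampliate (r : Type*) [Fintype r] (N : Channel a b) : Channel (r × a) (r × b) where
  map := QInfo.ampliate r N.map
  completelyPositive k M hM := by
    classical
    obtain ⟨K, hK⟩ := N.exists_map_eq_krausMap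
    rw [hK, ampliate_krausMap, ampliate_krausMap]
    exact posSemidef_krausMap _ hM
  tracePreserving := trace_ampliate N.tracePreserving

/-- The channel `N^{⊗n}` of `n` independent uses of `N`. -/
def tensorPower [DecidableEq a] (n : ℕ) (N : Channel a b) : Channel (Fin n → a) (Fin n → b) where
  map := QInfo.tensorPower n N.map
  completelyPositive k M hM := by
    obtain ⟨K, hK⟩ := N.exists_map_eq_krausMap
    rw [hK, tensorPower_krausMap, ampliate_krausMap]
    exact posSemidef_krausMap _ hM
  tracePreserving := trace_tensorPower n N.tracePreserving

end Channel

section Power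

variable {m : Type*} [Fintype m] [DecidableEq m] {ρ : Matrix m m ℂ}

lemma nonneg_of_mem_spectrum (hρ : ρ.PosSemidef) {x : ℝ} (hx : x ∈ spectrum ℝ ρ) : 0 ≤ x := by
  rw [hρ.1.spectrum_real_eq_range_eigenvalues] at hx
  obtain ⟨i, rfl⟩ := hx
  exact hρ.eigenvalues_nonneg i

lemma cfc_mulVec_of_mulVec_eq_smul (hρ : ρ.IsHermitian) (f : ℝ → ℝ) {v : m → ℂ} {x : ℝ}
    (hv : ρ.mulVec v = x • v) : (cfc f ρ).mulVec v = f x • v := by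
  have hρ : IsSelfAdjoint ρ := hρ
  have hc : ∀ g : ℝ → ℝ, ContinuousOn g (spectrum ℝ ρ) := finite_real_spectrum.continuousOn
  have hf : f = fun y ↦ (f y - f x) / (y - x) * (y - x) + f x := by
    ext y
    rcases eq_or_ne y x with rfl | hy
    · simp
    · rw [div_mul_cancel₀ _ (sub_ne_zero.2 hy), sub_add_cancel]
  have hcfc : cfc f ρ = cfc (fun y ↦ (f y - f x) / (y - x)) ρ * (ρ - x • 1) + f x • 1 := by
    conv_lhs => rw [hf]
    rw [cfc_add_const _ _ _ (hc _), cfc_mul _ _ _ (hc _) (hc _), cfc_sub _ _ _ (hc _) (hc _),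
      cfc_id' ℝ ρ, cfc_const x ρ, Algebra.algebraMap_eq_smul_one, Algebra.algebraMap_eq_smul_one]
  rw [hcfc, add_mulVec, ← mulVec_mulVec, sub_mulVec, hv, smul_mulVec, one_mulVec, sub_self,
    mulVec_zero, zero_add, smul_mulVec, one_mulVec]

lemma mpow_diagonal (d : m → ℝ) (t : ℝ) :
    mpow (diagonal fun i ↦ (d i : ℂ)) t = diagonal fun i ↦ ((d i ^ t : ℝ) : ℂ) := by
  have hd : (diagonal fun i ↦ (d i : ℂ)).IsHermitian :=
    isHermitian_diagonal_of_self_adjoint _ (funext fun _ ↦ Complex.conj_ofReal _)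
  refine ext_of_mulVec_single fun i ↦ ?_
  rw [mpow, cfc_mulVec_of_mulVec_eq_smul hd _ (x := d i)] <;>
    simp [mulVec_single, ← Pi.single_smul]

lemma mpow_one_kronecker {a : Type*} [Fintype a] [DecidableEq a] (hρ : ρ.IsHermitian) (t : ℝ) :
    mpow ((1 : Matrix a a ℂ) ⊗ₖ ρ) t = (1 : Matrix a a ℂ) ⊗ₖ mpow ρ t := by
  let κ : Matrix m m ℂ →⋆ₐ[ℂ] Matrix (a × m) (a × m) ℂ :=
    { toFun := fun M ↦ (1 : Matrix a a ℂ) ⊗ₖ M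
      map_one' := one_kronecker_one
      map_mul' := fun M N ↦ by rw [← mul_kronecker_mul, Matrix.one_mul]
      map_zero' := kronecker_zero _
      map_add' := kronecker_add _
      commutes' := fun c ↦ by
        rw [Algebra.algebraMap_eq_smul_one, Algebra.algebraMap_eq_smul_one, kronecker_smul,
          one_kronecker_one]
      map_star' := fun M ↦ by
        rw [star_eq_conjTranspose, star_eq_conjTranspose, conjTranspose_kronecker,
          conjTranspose_one] }
  have hκ : Continuous κ := κ.toAlgHom.toLinearMap.continuous_of_finiteDimensional
  have hρ : IsSelfAdjoint ρ := hρ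
  exact (StarAlgHomClass.map_cfc (S := ℂ) κ (fun x : ℝ ↦ x ^ t) ρ
    (finite_real_spectrum.continuousOn _) hκ hρ (hρ.map κ)).symm

open scoped MatrixOrder in
lemma posSemidef_mpow (hρ : ρ.PosSemidef) (t : ℝ) : (mpow ρ t).PosSemidef :=
  nonneg_iff_posSemidef.1 <| cfc_nonneg fun _ hx ↦ Real.rpow_nonneg (nonneg_of_mem_spectrum hρ hx) t

lemma mpow_one (hρ : ρ.IsHermitian) : mpow ρ 1 = ρ := by
  have hρ : IsSelfAdjoint ρ := hρ
  simpa only [mpow, Real.rpow_one] using cfc_id' ℝ ρ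

lemma mpow_mul_mpow (hρ : ρ.PosSemidef) {s t : ℝ} (hst : s + t ≠ 0) :
    mpow ρ s * mpow ρ t = mpow ρ (s + t) := by
  rw [mpow, mpow, mpow, ← cfc_mul _ _ ρ (finite_real_spectrum.continuousOn _)
    (finite_real_spectrum.continuousOn _)]
  exact cfc_congr fun x hx ↦ (Real.rpow_add' (nonneg_of_mem_spectrum hρ hx) hst).symm

lemma mpow_mpow (hρ : ρ.PosSemidef) (s t : ℝ) : mpow (mpow ρ s) t = mpow ρ (s * t) := by
  have hsa : IsSelfAdjoint ρ := hρ.1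
  rw [mpow, mpow, mpow, ← cfc_comp' _ _ ρ ((finite_real_spectrum.image _).continuousOn _)
    (finite_real_spectrum.continuousOn _)]
  exact cfc_congr fun x hx ↦ (Real.rpow_mul (nonneg_of_mem_spectrum hρ hx) s t).symm

lemma mpow_smul (hρ : ρ.PosSemidef) {c : ℝ} (hc : 0 ≤ c) (t : ℝ) :
    mpow (c • ρ) t = c ^ t • mpow ρ t := by
  have hsa : IsSelfAdjoint ρ := hρ.1
  rw [mpow, mpow, ← cfc_comp_smul c _ ρ ((finite_real_spectrum.image _).continuousOn _),
    ← cfc_smul _ _ ρ (finite_real_spectrum.continuousOn _)]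
  exact cfc_congr fun x hx ↦ Real.mul_rpow hc (nonneg_of_mem_spectrum hρ hx)

lemma mulVec_eq_zero_of_mpow (hρ : ρ.PosSemidef) {t : ℝ} {v : m → ℂ}
    (h : (mpow ρ t).mulVec v = 0) : ρ.mulVec v = 0 := by
  rw [← mpow_one hρ.1, ← sub_add_cancel 1 t, ← mpow_mul_mpow hρ (by simp), ← mulVec_mulVec, h,
    mulVec_zero]

lemma trace_mpow_re_pos (hρ : ρ.PosSemidef) (hρ0 : ρ ≠ 0) (t : ℝ) : 0 < (mpow ρ t).trace.re := by
  have h := posSemidef_mpow hρ t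
  refine (Complex.le_def.1 h.trace_nonneg).1.lt_of_ne' fun h0 ↦ hρ0 ?_
  have htr : (mpow ρ t).trace = 0 :=
    Complex.ext h0 (Complex.le_def.1 h.trace_nonneg).2.symm
  refine ext_of_mulVec_single fun i ↦ ?_
  rw [zero_mulVec]
  exact mulVec_eq_zero_of_mpow hρ (t := t) (by rw [h.trace_eq_zero_iff.1 htr, zero_mulVec])

end Power

section Divergence

variable {m ι : Type*} [Fintype m] [DecidableEq m] [Fintype ι] [DecidableEq ι] {lam : ℝ}
  {ρ σ : Matrix m m ℂ}

lemma forall_diagonal_mulVec_eq_zero_iff (p q : m → ℝ) :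
    (∀ v : m → ℂ, (diagonal fun i ↦ (q i : ℂ)).mulVec v = 0 →
      (diagonal fun i ↦ (p i : ℂ)).mulVec v = 0) ↔ ∀ i, q i = 0 → p i = 0 := by
  refine ⟨fun h i hi ↦ ?_, fun h v hv ↦ funext fun i ↦ ?_⟩
  · simpa [mulVec_single, hi] using h (Pi.single i 1)
  · have hvi := congrFun hv i
    rw [mulVec_diagonal, Pi.zero_apply, mul_eq_zero, Complex.ofReal_eq_zero] at hvi ⊢
    exact hvi.imp_left (h i)

lemma trace_mpow_diagonal_mul_re (s t : ℝ) (p q : m → ℝ) :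
    (mpow (diagonal fun i ↦ (p i : ℂ)) s * mpow (diagonal fun i ↦ (q i : ℂ)) t).trace.re =
      ∑ i, p i ^ s * q i ^ t := by
  rw [mpow_diagonal, mpow_diagonal, diagonal_mul_diagonal, trace_diagonal, Complex.re_sum]
  refine Finset.sum_congr rfl fun i _ ↦ ?_
  rw [← Complex.ofReal_mul, Complex.ofReal_re]

lemma renyiTrace_of_ker_le (hsupp : ∀ v : m → ℂ, σ.mulVec v = 0 → ρ.mulVec v = 0) :
    renyiTrace lam ρ σ = ENNReal.ofReal (mpow ρ lam * mpow σ (1 - lam)).trace.re :=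
  if_pos hsupp

lemma renyiTrace_diagonal {p q : m → ℝ} (hpq : ∀ i, q i = 0 → p i = 0) :
    renyiTrace lam (diagonal fun i ↦ (p i : ℂ)) (diagonal fun i ↦ (q i : ℂ)) =
      ENNReal.ofReal (∑ i, p i ^ lam * q i ^ (1 - lam)) := by
  rw [renyiTrace_of_ker_le ((forall_diagonal_mulVec_eq_zero_iff p q).2 hpq),
    trace_mpow_diagonal_mul_re]

lemma renyiTrace_diagonal_eq_top {p q : m → ℝ} {i : m} (hq : q i = 0) (hp : p i ≠ 0) :
    renyiTrace lam (diagonal fun i ↦ (p i : ℂ)) (diagonal fun i ↦ (q i : ℂ)) = ⊤ :=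
  if_neg fun h ↦ hp ((forall_diagonal_mulVec_eq_zero_iff p q).1 h i hq)

lemma renyiTrace_measurement_le (h1 : 1 < lam) (h2 : lam ≤ 2) (hρ : ρ.PosSemidef)
    (hσ : σ.PosSemidef) {Q : ι → Matrix m m ℂ} (hQ : ∀ k, (Q k).PosSemidef)
    (hQ1 : (1 - ∑ k, Q k).PosSemidef) :
    renyiTrace lam (diagonal fun k ↦ (ρ * Q k).trace) (diagonal fun k ↦ (σ * Q k).trace) ≤
      renyiTrace lam ρ σ := by
  by_cases hsupp : ∀ v : m → ℂ, σ.mulVec v = 0 → ρ.mulVec v = 0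
  · rw [renyiTrace_of_ker_le hsupp, ← funext fun k ↦ ofReal_trace_mul_re hρ (hQ k),
      ← funext fun k ↦ ofReal_trace_mul_re hσ (hQ k),
      renyiTrace_diagonal fun k ↦ trace_mul_re_eq_zero_of_ker_le hσ hsupp (hQ k)]
    exact ENNReal.ofReal_le_ofReal (sum_trace_mul_rpow_le hρ hσ hsupp hQ hQ1 h1 h2)
  · exact le_top.trans_eq (if_neg hsupp).symm

lemma renyiDiv_le_of_renyiTrace_le {n : Type*} [Fintype n] [DecidableEq n] {τ ω : Matrix n n ℂ}
    (h1 : 1 ≤ lam) (h : renyiTrace lam ρ σ ≤ renyiTrace lam τ ω) :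
    renyiDiv lam ρ σ ≤ renyiDiv lam τ ω :=
  mul_le_mul_of_nonneg_left (ENNReal.log_monotone h)
    (EReal.coe_nonneg.2 (inv_nonneg.2 (sub_nonneg.2 h1)))

lemma renyiDiv_eq_coe_log {c : ℝ} (hc : 0 < c) (h : renyiTrace lam ρ σ = ENNReal.ofReal c) :
    renyiDiv lam ρ σ = (((lam - 1)⁻¹ * Real.log c : ℝ) : EReal) := by
  rw [renyiDiv, h, ENNReal.log_ofReal_of_pos hc, EReal.coe_mul]

end Divergence

namespace Channel

variable {a b : Type*} [Fintype a] [Fintype b]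

lemma krausMap_conjTranspose_one [DecidableEq a] [DecidableEq b] {κ : Type*} [Fintype κ]
    {N : Channel a b} {K : κ → Matrix b a ℂ} (hK : N.map = krausMap K) :
    krausMap (fun j ↦ (K j)ᴴ) 1 = 1 := by
  refine ext_iff_trace_mul_left.2 fun M ↦ ?_
  rw [← trace_krausMap_mul, ← hK, Matrix.mul_one, Matrix.mul_one, N.tracePreserving]

/- A measurement after the channel is a measurement before it, by the adjoint of the channel. -/
lemma renyiTrace_measurement_le (N : Channel a b) [DecidableEq a] [DecidableEq b] {ι : Type*}
    [Fintype ι] [DecidableEq ι] {lam : ℝ} (h1 : 1 < lam) (h2 : lam ≤ 2) {ρ σ : Matrix a a ℂ}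
    (hρ : ρ.PosSemidef) (hσ : σ.PosSemidef) {Q : ι → Matrix b b ℂ}
    (hQ : ∀ k, (Q k).PosSemidef) (hQ1 : (1 - ∑ k, Q k).PosSemidef) :
    renyiTrace lam (diagonal fun k ↦ (N.map ρ * Q k).trace)
      (diagonal fun k ↦ (N.map σ * Q k).trace) ≤ renyiTrace lam ρ σ := by
  obtain ⟨K, hK⟩ := N.exists_map_eq_krausMap
  simp only [hK, trace_krausMap_mul]
  refine QInfo.renyiTrace_measurement_le h1 h2 hρ hσ (fun k ↦ posSemidef_krausMap _ (hQ k)) ?_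
  rw [← krausMap_conjTranspose_one hK, ← map_sum, ← map_sub]
  exact posSemidef_krausMap _ hQ1

end Channel

section PartialTrace

variable {a b : Type*} [Fintype a]

lemma posSemidef_traceFst {M : Matrix (a × b) (a × b) ℂ} (hM : M.PosSemidef) :
    (traceFst M).PosSemidef := by
  have : traceFst M = ∑ x : a, M.submatrix (fun i ↦ (x, i)) fun i ↦ (x, i) := by
    ext i j
    simp only [traceFst, of_apply, Matrix.sum_apply, submatrix_apply]
  rw [this]
  exact posSemidef_sum _ fun x _ ↦ hM.submatrix _

variable [Fintype b]

lemma trace_traceFst (M : Matrix (a × b) (a × b) ℂ) : (traceFst M).trace = M.trace := by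
  simp only [trace, traceFst, diag_apply, of_apply, Fintype.sum_prod_type]
  exact Finset.sum_comm

variable [DecidableEq a]

lemma trace_mul_one_kronecker (M : Matrix (a × b) (a × b) ℂ) (B : Matrix b b ℂ) :
    (M * ((1 : Matrix a a ℂ) ⊗ₖ B)).trace = (traceFst M * B).trace := by
  simp only [trace, traceFst, diag_apply, mul_apply, of_apply, kroneckerMap_apply, one_apply,
    Fintype.sum_prod_type, ite_mul, one_mul, zero_mul, mul_ite, mul_zero, Finset.sum_mul,
    Finset.sum_ite_irrel, Finset.sum_const_zero, Finset.sum_ite_eq', Finset.mem_univ, if_true]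
  rw [Finset.sum_comm]
  exact Finset.sum_congr rfl fun i _ ↦ Finset.sum_comm

lemma mulVec_eq_zero_of_traceFst {M : Matrix (a × b) (a × b) ℂ}
    (hM : M.PosSemidef) {σ : Matrix b b ℂ}
    (hσ : ∀ w : b → ℂ, σ.mulVec w = 0 → (traceFst M).mulVec w = 0) {v : a × b → ℂ}
    (hv : ((1 : Matrix a a ℂ) ⊗ₖ σ).mulVec v = 0) : M.mulVec v = 0 := by
  classical
  set B : Matrix b a ℂ := of fun i x ↦ v (x, i) with hB
  have hv_eq : v = ((1 : Matrix a a ℂ) ⊗ₖ B).mulVec fun p ↦ if p.1 = p.2 then 1 else 0 := by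
    ext ⟨x, i⟩
    simp [mulVec, dotProduct, Fintype.sum_prod_type, one_apply, hB]
  have hσB : σ * B = 0 := by
    ext i x
    have := congrFun hv (x, i)
    simpa [mulVec, dotProduct, Fintype.sum_prod_type, one_apply, mul_apply, hB] using this
  have hzero : (M * ((1 : Matrix a a ℂ) ⊗ₖ (B * Bᴴ))).trace.re = 0 := by
    rw [trace_mul_one_kronecker, ← Matrix.mul_assoc, mul_eq_zero_of_ker_le hσ hσB,
      Matrix.zero_mul, trace_zero, Complex.zero_re]
  have hMB := mul_eq_zero_of_trace_mul_re_eq_zero hM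
    (PosSemidef.one.kronecker (posSemidef_self_mul_conjTranspose B)) hzero
  have hkron : (1 : Matrix a a ℂ) ⊗ₖ (B * Bᴴ) =
      ((1 : Matrix a a ℂ) ⊗ₖ B) * ((1 : Matrix a a ℂ) ⊗ₖ B)ᴴ := by
    rw [conjTranspose_kronecker, conjTranspose_one, ← mul_kronecker_mul, Matrix.one_mul]
  rw [hkron, mul_self_mul_conjTranspose_eq_zero] at hMB
  rw [hv_eq, mulVec_mulVec, hMB, zero_mulVec]

end PartialTrace

section Sibson

variable {a b : Type*} [Fintype a] [DecidableEq a] [Fintype b] [DecidableEq b] {lam : ℝ}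
  {ρ : Matrix (a × b) (a × b) ℂ}

/-- The trace `Tr (Tr_A ρ^lam)^(1/lam)`. By Sibson's identity `lam / (lam - 1)` times its logarithm
is the minimum of `D_lam(ρ ‖ 𝟙 ⊗ σ)` over density matrices `σ`. -/
noncomputable def sibsonTrace (lam : ℝ) (ρ : Matrix (a × b) (a × b) ℂ) : ℝ :=
  (mpow (traceFst (mpow ρ lam)) (1 / lam)).trace.re

/-- The density matrix proportional to `(Tr_A ρ^lam)^(1/lam)`, which minimises
`σ ↦ D_lam(ρ ‖ 𝟙 ⊗ σ)`. -/
noncomputable def sibsonState (lam : ℝ) (ρ : Matrix (a × b) (a × b) ℂ) : Matrix b b ℂ :=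
  (sibsonTrace lam ρ)⁻¹ • mpow (traceFst (mpow ρ lam)) (1 / lam)

lemma sibsonTrace_pos (hρ : ρ.PosSemidef) (hρ0 : ρ ≠ 0) : 0 < sibsonTrace lam ρ := by
  refine trace_mpow_re_pos (posSemidef_traceFst (posSemidef_mpow hρ lam)) (fun h ↦ ?_) _
  have htr := trace_mpow_re_pos hρ hρ0 lam
  rw [← trace_traceFst, h, trace_zero, Complex.zero_re] at htr
  exact htr.false

lemma trace_mpow_traceFst (hρ : ρ.PosSemidef) :
    (mpow (traceFst (mpow ρ lam)) (1 / lam)).trace = sibsonTrace lam ρ := by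
  have h := posSemidef_mpow (posSemidef_traceFst (posSemidef_mpow hρ lam)) (1 / lam)
  exact Complex.ext rfl (Complex.le_def.1 h.trace_nonneg).2.symm

lemma isDensity_sibsonState (hρ : ρ.PosSemidef) (hρ0 : ρ ≠ 0) : IsDensity (sibsonState lam ρ) := by
  have hc := sibsonTrace_pos (lam := lam) hρ hρ0
  refine ⟨(posSemidef_mpow (posSemidef_traceFst (posSemidef_mpow hρ lam)) _).smul
    (inv_nonneg.2 hc.le), ?_⟩
  rw [sibsonState, trace_smul, trace_mpow_traceFst hρ, Complex.real_smul, ← Complex.ofReal_mul,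
    inv_mul_cancel₀ hc.ne', Complex.ofReal_one]

lemma mulVec_eq_zero_of_sibsonState (hρ : ρ.PosSemidef) (hρ0 : ρ ≠ 0) {v : a × b → ℂ}
    (hv : ((1 : Matrix a a ℂ) ⊗ₖ sibsonState lam ρ).mulVec v = 0) : ρ.mulVec v = 0 := by
  have hlam := posSemidef_mpow hρ lam
  refine mulVec_eq_zero_of_mpow hρ (mulVec_eq_zero_of_traceFst hlam (fun w hw ↦ ?_) hv)
  rw [sibsonState, smul_mulVec] at hw
  exact mulVec_eq_zero_of_mpow (posSemidef_traceFst hlam)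
    ((smul_eq_zero.1 hw).resolve_left (inv_ne_zero (sibsonTrace_pos hρ hρ0).ne'))

lemma trace_mpow_mul_mpow_sibsonState (hρ : ρ.PosSemidef) (hρ0 : ρ ≠ 0) (hlam : lam ≠ 0) :
    (mpow ρ lam * mpow ((1 : Matrix a a ℂ) ⊗ₖ sibsonState lam ρ) (1 - lam)).trace.re =
      sibsonTrace lam ρ ^ lam := by
  set τ := traceFst (mpow ρ lam) with hτ
  set c := sibsonTrace lam ρ
  have hτpos : τ.PosSemidef := posSemidef_traceFst (posSemidef_mpow hρ lam)
  have hc0 : 0 < c := sibsonTrace_pos hρ hρ0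
  have hexp : 1 + 1 / lam * (1 - lam) = 1 / lam := by
    field_simp
    ring
  have hpow : τ * mpow (sibsonState lam ρ) (1 - lam) = c ^ (lam - 1) • mpow τ (1 / lam) := by
    rw [sibsonState, mpow_smul (posSemidef_mpow hτpos _) (inv_nonneg.2 hc0.le), mpow_mpow hτpos,
      Real.inv_rpow hc0.le, ← Real.rpow_neg hc0.le, neg_sub, mul_smul_comm]
    nth_rewrite 1 [← mpow_one hτpos.1]
    rw [mpow_mul_mpow hτpos (hexp.trans_ne (one_div_ne_zero hlam)), hexp]
  rw [mpow_one_kronecker (isDensity_sibsonState hρ hρ0).1.1, trace_mul_one_kronecker, ← hτ, hpow,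
    trace_smul, Complex.real_smul, Complex.re_ofReal_mul]
  exact (Real.rpow_sub_one hc0.ne' lam).symm ▸ div_mul_cancel₀ _ hc0.ne'

lemma renyiDiv_one_kronecker_sibsonState (hρ : ρ.PosSemidef) (hρ0 : ρ ≠ 0) (hlam : lam ≠ 0) :
    renyiDiv lam ρ ((1 : Matrix a a ℂ) ⊗ₖ sibsonState lam ρ) =
      ((lam / (lam - 1) * Real.log (sibsonTrace lam ρ) : ℝ) : EReal) := by
  have hc := sibsonTrace_pos (lam := lam) hρ hρ0
  have htrace : renyiTrace lam ρ ((1 : Matrix a a ℂ) ⊗ₖ sibsonState lam ρ) =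
      ENNReal.ofReal (sibsonTrace lam ρ ^ lam) := by
    rw [renyiTrace_of_ker_le fun v ↦ mulVec_eq_zero_of_sibsonState hρ hρ0,
      trace_mpow_mul_mpow_sibsonState hρ hρ0 hlam]
  rw [renyiDiv_eq_coe_log (Real.rpow_pos_of_pos hc lam) htrace, Real.log_rpow hc, ← mul_assoc,
    inv_mul_eq_div]

lemma condDiv_le_log_sibsonTrace (hρ : ρ.PosSemidef) (hρ0 : ρ ≠ 0) (hlam : lam ≠ 0) :
    condDiv lam ρ ≤ ((lam / (lam - 1) * Real.log (sibsonTrace lam ρ) : ℝ) : EReal) :=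
  (iInf₂_le _ (isDensity_sibsonState hρ hρ0)).trans_eq
    (renyiDiv_one_kronecker_sibsonState hρ hρ0 hlam)

end Sibson

section Binary

variable {lam α α' β p p' q q' : ℝ}

lemma pair_ofReal (x y : ℝ) : ![(x : ℂ), (y : ℂ)] = fun i ↦ ((![x, y] i : ℝ) : ℂ) := by
  ext i
  fin_cases i <;> rfl

lemma renyiTrace_diagonal_pair (hq : q = 0 → p = 0) (hq' : q' = 0 → p' = 0) :
    renyiTrace lam (diagonal ![(p : ℂ), (p' : ℂ)]) (diagonal ![(q : ℂ), (q' : ℂ)]) =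
      ENNReal.ofReal (p ^ lam * q ^ (1 - lam) + p' ^ lam * q' ^ (1 - lam)) := by
  rw [pair_ofReal, pair_ofReal, renyiTrace_diagonal (Fin.forall_fin_two.2 ⟨hq, hq'⟩),
    Fin.sum_univ_two]
  rfl

lemma binaryDiv_eq (hβ : 0 < β) (h : 1 / β - β = 0 → 1 - α = 0) :
    binaryDiv lam α β = ((lam - 1)⁻¹ : ℝ) * ENNReal.log (ENNReal.ofReal
      (α ^ lam * β ^ (1 - lam) + (1 - α) ^ lam * (1 / β - β) ^ (1 - lam))) := by
  rw [binaryDiv, renyiDiv, renyiTrace_diagonal_pair (fun h0 ↦ absurd h0 hβ.ne') h]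

lemma binaryDiv_eq_top (hlam : 1 < lam) (h : 1 / β - β = 0) (hα : 1 - α ≠ 0) :
    binaryDiv lam α β = ⊤ := by
  have htop : renyiTrace lam (diagonal ![(α : ℂ), ((1 - α : ℝ) : ℂ)])
      (diagonal ![(β : ℂ), ((1 / β - β : ℝ) : ℂ)]) = ⊤ := by
    rw [pair_ofReal, pair_ofReal, renyiTrace_diagonal_eq_top (i := 1) h hα]
  rw [binaryDiv, renyiDiv, htop, ENNReal.log_top,
    EReal.coe_mul_top_of_pos (inv_pos.2 (sub_pos.2 hlam))]

lemma binaryDiv_mono (hlam : 1 < lam) (hβ : 0 < β) (hβ1 : β ≤ 1) (hα : β ^ 2 ≤ α) (h : α ≤ α')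
    (hα' : α' ≤ 1) : binaryDiv lam α β ≤ binaryDiv lam α' β := by
  rcases hβ1.eq_or_lt with rfl | hβ1
  · rw [h.antisymm (hα'.trans ((one_pow 2).ge.trans hα))]
  have hc : 0 < 1 / β - β := by
    rw [sub_pos, lt_div_iff₀ hβ]
    nlinarith
  have hmin : β / (β + (1 / β - β)) = β ^ 2 := by
    field_simp
    ring
  have hmono := monotoneOn_rpow_mul_add_rpow_mul hβ hc.le hlam.le
  rw [hmin] at hmono
  rw [binaryDiv_eq hβ fun h0 ↦ absurd h0 hc.ne', binaryDiv_eq hβ fun h0 ↦ absurd h0 hc.ne']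
  exact mul_le_mul_of_nonneg_left
    (ENNReal.log_monotone (ENNReal.ofReal_le_ofReal
      (hmono ⟨hα, h.trans hα'⟩ ⟨hα.trans h, hα'⟩ h)))
    (EReal.coe_nonneg.2 (inv_nonneg.2 (sub_nonneg.2 hlam.le)))

lemma le_binaryDiv (hlam : 1 < lam) (hα : 0 < α) (hα1 : α ≤ 1) (hβ : 0 < β) (hβ1 : β ≤ 1) :
    ((lam / (lam - 1) * Real.log α - Real.log β : ℝ) : EReal) ≤ binaryDiv lam α β := by
  by_cases h : 1 / β - β = 0 → 1 - α = 0
  · have hl : 0 < lam - 1 := sub_pos.2 hlam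
    have hc : 0 ≤ 1 / β - β := by
      rw [sub_nonneg, le_div_iff₀ hβ]
      nlinarith
    have hlog : lam / (lam - 1) * Real.log α - Real.log β =
        (lam - 1)⁻¹ * Real.log (α ^ lam * β ^ (1 - lam)) := by
      rw [Real.log_mul (by positivity) (by positivity), Real.log_rpow hα, Real.log_rpow hβ]
      field_simp
      ring
    rw [binaryDiv_eq hβ h, hlog, EReal.coe_mul, ← ENNReal.log_ofReal_of_pos (by positivity)]
    refine mul_le_mul_of_nonneg_left (ENNReal.log_monotone (ENNReal.ofReal_le_ofReal ?_))
      (EReal.coe_nonneg.2 (inv_nonneg.2 hl.le))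
    exact le_add_of_nonneg_right
      (mul_nonneg (Real.rpow_nonneg (sub_nonneg.2 hα1) _) (Real.rpow_nonneg hc _))
  · rw [binaryDiv_eq_top hlam (Classical.not_imp.1 h).1 (Classical.not_imp.1 h).2]
    exact le_top

lemma binaryDiv_le_renyiDiv_of_test {a b : Type*} [Fintype a] [DecidableEq a] [Fintype b]
    [DecidableEq b] (N : Channel a b) (h1 : 1 < lam) (h2 : lam ≤ 2) {ρ σ : Matrix a a ℂ}
    (hρ : ρ.PosSemidef) (hσ : σ.PosSemidef) {E G : Matrix b b ℂ} (hE : E.PosSemidef)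
    (hEG : (G - E).PosSemidef) (hG : (1 - G).PosSemidef)
    (hρE : (N.map ρ * E).trace = α) (hρG : (N.map ρ * G).trace = 1)
    (hσE : (N.map σ * E).trace = β) (hσG : (N.map σ * G).trace = (β : ℂ)⁻¹) :
    binaryDiv lam α β ≤ renyiDiv lam ρ σ := by
  have hsum : ∑ k, ![E, G - E] k = G := by
    rw [Fin.sum_univ_two]
    exact add_sub_cancel E G
  have hρk : (fun k ↦ (N.map ρ * ![E, G - E] k).trace) = ![(α : ℂ), ((1 - α : ℝ) : ℂ)] := by
    ext k
    fin_cases k <;> simp [Matrix.mul_sub, hρE, hρG]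
  have hσk : (fun k ↦ (N.map σ * ![E, G - E] k).trace) =
      ![(β : ℂ), ((1 / β - β : ℝ) : ℂ)] := by
    ext k
    fin_cases k <;> simp [Matrix.mul_sub, hσE, hσG]
  refine renyiDiv_le_of_renyiTrace_le h1.le ?_
  rw [← hρk, ← hσk]
  exact N.renyiTrace_measurement_le h1 h2 hρ hσ (Fin.forall_fin_two.2 ⟨hE, hEG⟩) (hsum.symm ▸ hG)

end Binary

section MaximallyEntangled

open scoped MatrixOrder in
lemma posSemidef_of_isStarProjection {m : Type*} [Fintype m] {p : Matrix m m ℂ}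
    (hp : IsStarProjection p) : p.PosSemidef :=
  nonneg_iff_posSemidef.1 hp.nonneg

lemma isStarProjection_kronecker_one {m k : Type*} [Fintype m] [Fintype k] [DecidableEq k]
    {p : Matrix m m ℂ} (hp : IsStarProjection p) :
    IsStarProjection (p ⊗ₖ (1 : Matrix k k ℂ)) := by
  refine isStarProjection_iff'.2 ⟨?_, ?_⟩
  · rw [← mul_kronecker_mul, hp.isIdempotentElem.eq, Matrix.one_mul]
  · rw [star_eq_conjTranspose, conjTranspose_kronecker, conjTranspose_one,
      ← star_eq_conjTranspose, hp.isSelfAdjoint.star_eq]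

lemma isStarProjection_vecMulVec_star {m : Type*} [Fintype m] {v : m → ℂ}
    (hv : star v ⬝ᵥ v = 1) : IsStarProjection (vecMulVec v (star v)) := by
  refine isStarProjection_iff'.2 ⟨?_, (posSemidef_vecMulVec_self_star v).1⟩
  rw [vecMulVec_mul_vecMulVec, hv, one_smul]

variable {A S : Type*} [Fintype A] [Fintype S] [DecidableEq S] {φ : A × S → ℂ}

/-- The vector `φ` is maximally entangled with the second system: the reduced state there is
completely mixed. If that system is nontrivial, this forces `φ` to be a unit vector. -/
def IsMaximallyEntangled (φ : A × S → ℂ) : Prop :=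
  traceFst (vecMulVec φ (star φ)) = (Fintype.card S : ℂ)⁻¹ • 1

/-- The projection onto the support of the reduced state on the reference of a vector `φ` that is
maximally entangled with the second system. With `M` the matrix of amplitudes of `φ`, the reduced
state is `M * Mᴴ`, and its nonzero eigenvalues all equal `(Fintype.card S)⁻¹`. -/
noncomputable def refProj (φ : A × S → ℂ) : Matrix A A ℂ :=
  (Fintype.card S : ℂ) • (of (Function.curry φ) * (of (Function.curry φ))ᴴ)

namespace IsMaximallyEntangled

lemma conjTranspose_mul_self (hφ : IsMaximallyEntangled φ) :
    (of (Function.curry φ))ᴴ * of (Function.curry φ) =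
      (Fintype.card S : ℂ)⁻¹ • (1 : Matrix S S ℂ) := by
  have htranspose : (of (Function.curry φ))ᴴ * of (Function.curry φ) =
      (traceFst (vecMulVec φ (star φ)))ᵀ := by
    ext i j
    exact Finset.sum_congr rfl fun a _ ↦ mul_comm _ _
  rw [htranspose, hφ, transpose_smul, transpose_one]

lemma trace_one_kronecker_mul [DecidableEq A] (hφ : IsMaximallyEntangled φ) (τ : Matrix S S ℂ) :
    (((1 : Matrix A A ℂ) ⊗ₖ τ) * vecMulVec φ (star φ)).trace =
      (Fintype.card S : ℂ)⁻¹ * τ.trace := by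
  rw [trace_mul_comm, trace_mul_one_kronecker, hφ, Matrix.smul_mul, Matrix.one_mul, trace_smul,
    smul_eq_mul]

variable [Nonempty S]

lemma star_dotProduct_self (hφ : IsMaximallyEntangled φ) : star φ ⬝ᵥ φ = 1 := by
  rw [dotProduct_comm, ← trace_vecMulVec, ← trace_traceFst, hφ, trace_smul, trace_one,
    smul_eq_mul, inv_mul_cancel₀ (Nat.cast_ne_zero.2 Fintype.card_ne_zero)]

lemma refProj_mul (hφ : IsMaximallyEntangled φ) :
    refProj φ * of (Function.curry φ) = of (Function.curry φ) := by
  rw [refProj, Matrix.smul_mul, Matrix.mul_assoc, hφ.conjTranspose_mul_self, Matrix.mul_smul,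
    Matrix.mul_one, smul_inv_smul₀ (Nat.cast_ne_zero.2 Fintype.card_ne_zero)]

lemma isStarProjection_refProj (hφ : IsMaximallyEntangled φ) : IsStarProjection (refProj φ) := by
  refine isStarProjection_iff'.2 ⟨?_, ?_⟩
  · nth_rewrite 2 [refProj]
    rw [mul_smul_comm, ← Matrix.mul_assoc, hφ.refProj_mul, refProj]
  · rw [refProj, star_smul, star_natCast, star_eq_conjTranspose, conjTranspose_mul,
      conjTranspose_conjTranspose]

lemma trace_refProj (hφ : IsMaximallyEntangled φ) : (refProj φ).trace = Fintype.card S := by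
  rw [refProj, trace_smul, trace_mul_comm, hφ.conjTranspose_mul_self, ← trace_smul,
    smul_inv_smul₀ (Nat.cast_ne_zero.2 Fintype.card_ne_zero), trace_one]

lemma refProj_kronecker_one_mulVec (hφ : IsMaximallyEntangled φ) :
    (refProj φ ⊗ₖ (1 : Matrix S S ℂ)).mulVec φ = φ := by
  ext ⟨a, s⟩
  calc (refProj φ ⊗ₖ (1 : Matrix S S ℂ)).mulVec φ (a, s) =
        (refProj φ * of (Function.curry φ)) a s := by
        simp only [mulVec, dotProduct, kroneckerMap_apply, Fintype.sum_prod_type, one_apply,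
          mul_ite, mul_one, mul_zero, ite_mul, zero_mul, Finset.sum_ite_eq, Finset.mem_univ,
          if_true, mul_apply, of_apply, Function.curry_apply]
    _ = φ (a, s) := by rw [hφ.refProj_mul]; rfl

lemma refProj_kronecker_one_mul_vecMulVec (hφ : IsMaximallyEntangled φ) :
    (refProj φ ⊗ₖ (1 : Matrix S S ℂ)) * vecMulVec φ (star φ) = vecMulVec φ (star φ) := by
  rw [mul_vecMulVec, hφ.refProj_kronecker_one_mulVec]

lemma posSemidef_refProj_kronecker_one_sub (hφ : IsMaximallyEntangled φ) :
    (refProj φ ⊗ₖ (1 : Matrix S S ℂ) - vecMulVec φ (star φ)).PosSemidef :=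
  posSemidef_of_isStarProjection
    ((isStarProjection_vecMulVec_star hφ.star_dotProduct_self).sub_of_mul_eq_right
      (isStarProjection_kronecker_one hφ.isStarProjection_refProj)
      hφ.refProj_kronecker_one_mul_vecMulVec)

lemma posSemidef_one_sub_refProj_kronecker_one [DecidableEq A] (hφ : IsMaximallyEntangled φ) :
    (1 - refProj φ ⊗ₖ (1 : Matrix S S ℂ)).PosSemidef :=
  posSemidef_of_isStarProjection
    (isStarProjection_kronecker_one hφ.isStarProjection_refProj).one_sub

end IsMaximallyEntangled

end MaximallyEntangled

namespace Protocol

variable {X Y A S : Type*} [Fintype X] [Fintype Y] [Fintype A] [Fintype S] [DecidableEq S]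
  {N : Channel X Y} {n : ℕ}

lemma nonempty (P : Protocol N n A S) : Nonempty S := by
  by_contra h
  rw [not_nonempty_iff] at h
  simpa only [dotProduct, Finset.univ_eq_empty, Finset.sum_empty, zero_ne_one] using P.norm_φ

lemma isMaximallyEntangled (P : Protocol N n A S) : IsMaximallyEntangled P.φ :=
  P.mixed_φ

variable [DecidableEq X]

lemma posSemidef_received (P : Protocol N n A S) : P.received.PosSemidef :=
  ((N.tensorPower n).ampliate A).posSemidef_map
    ((P.enc.ampliate A).posSemidef_map (posSemidef_vecMulVec_self_star P.φ))

lemma trace_received (P : Protocol N n A S) : P.received.trace = 1 := by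
  rw [received, trace_ampliate (trace_tensorPower n N.tracePreserving), encoded,
    trace_ampliate P.enc.tracePreserving, trace_vecMulVec, dotProduct_comm, P.norm_φ]

lemma received_ne_zero (P : Protocol N n A S) : P.received ≠ 0 := fun h ↦
  zero_ne_one ((trace_zero _ _).symm.trans (h ▸ P.trace_received))

lemma posSemidef_decoded (P : Protocol N n A S) : P.decoded.PosSemidef :=
  (P.dec.ampliate A).posSemidef_map P.posSemidef_received

lemma trace_decoded_mul_vecMulVec (P : Protocol N n A S) :
    (P.decoded * vecMulVec P.φ (star P.φ)).trace = (P.fidelity : ℂ) := by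
  rw [← ofReal_trace_mul_re P.posSemidef_decoded (posSemidef_vecMulVec_self_star P.φ), fidelity,
    mul_vecMulVec, trace_vecMulVec, dotProduct_comm]

/- The encoder, the channel and the decoder leave the reference untouched. -/
lemma trace_decoded_mul_refProj (P : Protocol N n A S) :
    (P.decoded * (refProj P.φ ⊗ₖ (1 : Matrix S S ℂ))).trace = 1 := by
  classical
  have := P.nonempty
  rw [trace_mul_comm, decoded, trace_kronecker_one_mul_ampliate P.dec.tracePreserving, received,
    trace_kronecker_one_mul_ampliate (trace_tensorPower n N.tracePreserving), encoded,
    trace_kronecker_one_mul_ampliate P.enc.tracePreserving,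
    P.isMaximallyEntangled.refProj_kronecker_one_mul_vecMulVec, trace_vecMulVec, dotProduct_comm,
    P.norm_φ]

lemma fidelity_le_one (P : Protocol N n A S) : P.fidelity ≤ 1 := by
  have := P.nonempty
  have h := trace_mul_re_nonneg P.posSemidef_decoded
    P.isMaximallyEntangled.posSemidef_refProj_kronecker_one_sub
  rw [Matrix.mul_sub, trace_sub, P.trace_decoded_mul_refProj, P.trace_decoded_mul_vecMulVec,
    Complex.sub_re, Complex.one_re, Complex.ofReal_re] at h
  exact sub_nonneg.1 h

lemma binaryDiv_fidelity_le_condDiv [DecidableEq Y] [DecidableEq A] (P : Protocol N n A S)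
    {lam : ℝ} (h1 : 1 < lam) (h2 : lam ≤ 2) :
    binaryDiv lam P.fidelity (Fintype.card S : ℝ)⁻¹ ≤ condDiv lam P.received := by
  have := P.nonempty
  have hφ := P.isMaximallyEntangled
  refine le_iInf₂ fun σ hσ ↦ ?_
  have hdec : (P.dec.ampliate A).map (kronecker (1 : Matrix A A ℂ) σ) =
      (1 : Matrix A A ℂ) ⊗ₖ P.dec.map σ :=
    ampliate_one_kronecker P.dec.map σ
  have htr : (P.dec.map σ).trace = 1 := (P.dec.tracePreserving σ).trans hσ.2
  refine binaryDiv_le_renyiDiv_of_test (P.dec.ampliate A) h1 h2 P.posSemidef_received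
    (PosSemidef.one.kronecker hσ.1) (posSemidef_vecMulVec_self_star P.φ)
    hφ.posSemidef_refProj_kronecker_one_sub hφ.posSemidef_one_sub_refProj_kronecker_one
    P.trace_decoded_mul_vecMulVec P.trace_decoded_mul_refProj ?_ ?_
  · rw [hdec, hφ.trace_one_kronecker_mul, htr, mul_one, Complex.ofReal_inv, Complex.ofReal_natCast]
  · rw [hdec, ← mul_kronecker_mul, Matrix.one_mul, Matrix.mul_one, trace_kronecker, htr,
      hφ.trace_refProj, mul_one, Complex.ofReal_inv, Complex.ofReal_natCast, inv_inv]

lemma log_fidelity_add_log_card_le [DecidableEq Y] [DecidableEq A] (P : Protocol N n A S)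
    {lam : ℝ} (h1 : 1 < lam) (h2 : lam ≤ 2) (hf : 0 < P.fidelity) :
    lam / (lam - 1) * Real.log P.fidelity + Real.log (Fintype.card S) ≤
      lam / (lam - 1) * Real.log (sibsonTrace lam P.received) := by
  have := P.nonempty
  have h0 : lam ≠ 0 := (one_pos.trans h1).ne'
  have hβ : (0 : ℝ) < (Fintype.card S : ℝ)⁻¹ := inv_pos.2 (Nat.cast_pos.2 Fintype.card_pos)
  have hβ1 : (Fintype.card S : ℝ)⁻¹ ≤ 1 :=
    inv_le_one_of_one_le₀ (Nat.one_le_cast.2 Fintype.card_pos)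
  rw [← sub_neg_eq_add, ← Real.log_inv, ← EReal.coe_le_coe_iff]
  calc ((lam / (lam - 1) * Real.log P.fidelity - Real.log (Fintype.card S : ℝ)⁻¹ : ℝ) : EReal)
      ≤ binaryDiv lam P.fidelity (Fintype.card S : ℝ)⁻¹ :=
        le_binaryDiv h1 hf P.fidelity_le_one hβ hβ1
    _ ≤ condDiv lam P.received := P.binaryDiv_fidelity_le_condDiv h1 h2
    _ ≤ _ := condDiv_le_log_sibsonTrace P.posSemidef_received P.received_ne_zero h0

lemma gallagerE0_encoded [DecidableEq Y] [DecidableEq A] (P : Protocol N n A S) (s : ℝ) :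
    gallagerE0 s (QInfo.tensorPower n N.map) P.encoded =
      -Real.log (sibsonTrace (1 / (s + 1)) P.received) := by
  rw [sibsonTrace, one_div_one_div]
  rfl

lemma fidelity_le_exp [DecidableEq Y] [DecidableEq A] (P : Protocol N n A S) {s : ℝ}
    (hs : -(1 / 2) ≤ s) (hs0 : s < 0) :
    P.fidelity ≤ Real.exp (s * Real.log (Fintype.card S) -
      gallagerE0 s (QInfo.tensorPower n N.map) P.encoded) := by
  rcases le_or_gt P.fidelity 0 with hf | hf
  · exact hf.trans (Real.exp_pos _).le
  have hs1 : 0 < s + 1 := by linarith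
  have h1 : 1 < 1 / (s + 1) := (lt_div_iff₀ hs1).2 (by linarith)
  have h2 : 1 / (s + 1) ≤ 2 := (div_le_iff₀ hs1).2 (by linarith)
  have hcoef : 1 / (s + 1) / (1 / (s + 1) - 1) = (-s)⁻¹ := by
    have hsub : 1 / (s + 1) - 1 = -s / (s + 1) := by
      field_simp
      ring
    rw [hsub, div_div_div_cancel_right₀ hs1.ne', one_div]
  have hlog := mul_le_mul_of_nonneg_left (P.log_fidelity_add_log_card_le h1 h2 hf)
    (neg_nonneg.2 hs0.le)
  rw [hcoef, mul_add, mul_inv_cancel_left₀ (neg_ne_zero.2 hs0.ne),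
    mul_inv_cancel_left₀ (neg_ne_zero.2 hs0.ne)] at hlog
  rw [← Real.log_le_iff_le_exp hf, P.gallagerE0_encoded]
  linarith

namespace IsCode

variable {P : Protocol N n A S} {R ε F : ℝ}

lemma mul_eq_log (hP : P.IsCode R ε) (hn : n ≠ 0) : n * R = Real.log (Fintype.card S) := by
  rw [hP.1, mul_div_cancel₀ _ (Nat.cast_ne_zero.2 hn)]

lemma exp_neg_eq (hP : P.IsCode R ε) (hn : n ≠ 0) :
    Real.exp (-(n * R)) = (Fintype.card S : ℝ)⁻¹ := by
  have := P.nonempty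
  rw [hP.mul_eq_log hn, Real.exp_neg, Real.exp_log (Nat.cast_pos.2 Fintype.card_pos)]

lemma exp_neg_le_one (hP : P.IsCode R ε) (hn : n ≠ 0) : Real.exp (-(n * R)) ≤ 1 := by
  have := P.nonempty
  rw [hP.exp_neg_eq hn]
  exact inv_le_one_of_one_le₀ (Nat.one_le_cast.2 Fintype.card_pos)

lemma le_fidelity (hP : P.IsCode R (1 - F)) : F ≤ P.fidelity :=
  (sub_sub_cancel 1 F).ge.trans hP.2

end IsCode

end Protocol

end QInfo

theorem theorem1_general {X Y A S : Type*} [Fintype X] [DecidableEq X] [Fintype Y] [DecidableEq Y]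
    [Fintype A] [DecidableEq A] [Fintype S] [DecidableEq S]
    (N : QInfo.Channel X Y) (n : ℕ) (hn : 0 < n) (R F : ℝ)
    (P : QInfo.Protocol N n A S) (hP : P.IsCode R (1 - F)) :
    (Real.exp (-(n * R)) ^ 2 ≤ F → ∀ lam : ℝ, 1 < lam → lam ≤ 2 →
      QInfo.binaryDiv lam F (Real.exp (-(n * R))) ≤ QInfo.condDiv lam P.received) ∧
    (∀ s : ℝ, -(1 / 2) ≤ s → s < 0 →
      F ≤ Real.exp (s * n * R -
        QInfo.gallagerE0 s (QInfo.tensorPower n N.map) P.encoded)) := by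
  refine ⟨fun hF lam h1 h2 ↦ ?_, fun s hs hs0 ↦ ?_⟩
  · calc QInfo.binaryDiv lam F (Real.exp (-(n * R)))
        ≤ QInfo.binaryDiv lam P.fidelity (Real.exp (-(n * R))) :=
          QInfo.binaryDiv_mono h1 (Real.exp_pos _) (hP.exp_neg_le_one hn.ne') hF hP.le_fidelity
            P.fidelity_le_one
      _ ≤ QInfo.condDiv lam P.received := by
          rw [hP.exp_neg_eq hn.ne']
          exact P.binaryDiv_fidelity_le_condDiv h1 h2
  · rw [mul_assoc, hP.mul_eq_log hn.ne']
    exact hP.le_fidelity.trans (P.fidelity_le_exp hs hs0)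

theorem theorem1 {X Y A S : Type*} [Fintype X] [DecidableEq X] [Fintype Y] [DecidableEq Y]
    [Fintype A] [DecidableEq A] [Fintype S] [DecidableEq S]
    (N : QInfo.Channel X Y) (n : ℕ) (hn : 0 < n) (R F : ℝ)
    (P : QInfo.Protocol N n A S) (hP : P.IsCode R (1 - F))
    (hF : Real.exp (-(n * R)) ≤ F) :
    (∀ lam : ℝ, 1 < lam → lam ≤ 2 →
      QInfo.binaryDiv lam F (Real.exp (-(n * R))) ≤ QInfo.condDiv lam P.received) ∧
    (∀ s : ℝ, -(1 / 2) ≤ s → s < 0 →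
      F ≤ Real.exp (s * n * R -
        QInfo.gallagerE0 s (QInfo.tensorPower n N.map) P.encoded)) := by
  obtain ⟨hdiv, hexp⟩ := theorem1_general N n hn R F P hP
  exact ⟨hdiv ((pow_le_of_le_one (Real.exp_pos _).le (hP.exp_neg_le_one hn.ne')
    two_ne_zero).trans hF), hexp⟩
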